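/- Let $K$ be a tetrahedral mesh embedded in $\mathbb{R}^3$, i.e. a finite geometric simplicial complex in $\mathbb{R}^3$ in which every simplex is a face of a tetrahedron of $K$. Assume that $K$ is (pairwise) Delaunay: whenever two tetrahedra $\lambda,\rho$ of $K$ share a triangle, the vertex of $\rho$ opposite to the shared triangle does not lie in the open ball bounded by the circumsphere of $\lambda$. (This holds in particular if no vertex of $K$ lies strictly inside the circumsphere of a tetrahedron of $K$.) Let $v$ be an internal vertex of $K$, i.e. a vertex lying in the interior of the union of the simplices of $K$. For a simplex $\sigma$ let $c_\sigma$ denote its circumcenter. For each flag $\{v\}=\sigma^0\prec\sigma^1\prec\sigma^2\prec\sigma^3$ of simplices of $K$ with $\dim\sigma^i=i$, the corresponding elementary dual simplex of $v$ is the convex hull of $c_{\sigma^0},c_{\sigma^1},c_{\sigma^2},c_{\sigma^3}$. Its sign is $s_0s_1s_2$, where $s_i=+1$ if, within the affine hull of $\sigma^{i+1}$, the circumcenter $c_{\sigma^{i+1}}$ lies in the same open half space bounded by the affine hull of $\sigma^i$ as the vertex of $\sigma^{i+1}$ not in $\sigma^i$, and $s_i=-1$ otherwise. The signed volume of the circumcentric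 dual cell $\star v$ is the sum, over all such flags, of the sign times the volume of the elementary dual simplex. Then the signed volume of $\star v$ is positive. -/

import Mathlib

open scoped Classical in
/-- The circumsphere of the simplex with vertex set `s`: for a nonempty affinely independent `s` it
is Mathlib's circumsphere of the simplex obtained by listing the vertices in some order (the order
is irrelevant, see `finsetCircumsphere_spec` and `finsetCircumsphere_unique`). The value `⟨0, 0⟩`
is used only when `s` is not the vertex set of a simplex. -/
noncomputable def finsetCircumsphere {V : Type*} [NormedAddCommGroup V] [InnerProductSpace ℝ V]
    (s : Finset V) : EuclideanGeometry.Sphere V :=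
  if h : s.Nonempty ∧ AffineIndependent ℝ ((↑) : s → V) then
    Affine.Simplex.circumsphere (n := s.card - 1)
      ⟨fun i => (s.equivFinOfCardEq
          (Nat.sub_add_cancel (Finset.card_pos.mpr h.1)).symm).symm i,
        h.2.comp_embedding (s.equivFinOfCardEq
          (Nat.sub_add_cancel (Finset.card_pos.mpr h.1)).symm).symm.toEmbedding⟩
  else ⟨0, 0⟩

/-- The circumsphere is centred in the affine hull of the simplex and passes through its
vertices. -/
theorem finsetCircumsphere_spec {V : Type*} [NormedAddCommGroup V] [InnerProductSpace ℝ V]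
    {s : Finset V} (hs : s.Nonempty) (hi : AffineIndependent ℝ ((↑) : s → V)) :
    (finsetCircumsphere s).center ∈ affineSpan ℝ (s : Set V) ∧
      ∀ x ∈ s, x ∈ finsetCircumsphere s := by
  have h : s.Nonempty ∧ AffineIndependent ℝ ((↑) : s → V) := ⟨hs, hi⟩
  rw [finsetCircumsphere, dif_pos h]
  set e := s.equivFinOfCardEq (Nat.sub_add_cancel (Finset.card_pos.mpr h.1)).symm
  set T : Affine.Simplex ℝ V (s.card - 1) :=
    ⟨fun i => e.symm i, h.2.comp_embedding e.symm.toEmbedding⟩ with hT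
  have hr : Set.range T.points = (s : Set V) := by
    ext x
    constructor
    · rintro ⟨i, rfl⟩
      exact (e.symm i).2
    · intro hx
      exact ⟨e ⟨x, hx⟩, by simp [hT]⟩
  refine ⟨?_, fun x hx => ?_⟩
  · have := T.circumcenter_mem_affineSpan
    rwa [hr] at this
  · have hx' : x ∈ Set.range T.points := by rw [hr]; exact hx
    obtain ⟨i, rfl⟩ := hx'
    exact T.mem_circumsphere i

/-- The two properties of `finsetCircumsphere_spec` determine the circumsphere. -/
theorem finsetCircumsphere_unique {V : Type*} [NormedAddCommGroup V] [InnerProductSpace ℝ V]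
    {s : Finset V} (hs : s.Nonempty) (hi : AffineIndependent ℝ ((↑) : s → V))
    (S : EuclideanGeometry.Sphere V) (hc : S.center ∈ affineSpan ℝ (s : Set V))
    (hS : ∀ x ∈ s, x ∈ S) : S = finsetCircumsphere s := by
  have hne : Nonempty s := hs.to_subtype
  have hspec := finsetCircumsphere_spec hs hi
  have hr : Set.range ((↑) : s → V) = (s : Set V) := Subtype.range_coe
  refine hi.existsUnique_dist_eq.unique ⟨?_, ?_⟩ ⟨?_, ?_⟩
  · rw [hr]; exact hc
  · rintro _ ⟨x, rfl⟩; exact hS x x.2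
  · rw [hr]; exact hspec.1
  · rintro _ ⟨x, rfl⟩; exact hspec.2 x x.2

/-- A tetrahedral mesh embedded in `ℝ³`: a finite geometric simplicial complex in which every
simplex is a face of a tetrahedron. -/
structure IsTetrahedralMesh
    (K : Geometry.SimplicialComplex ℝ (EuclideanSpace ℝ (Fin 3))) : Prop where
  finite : K.faces.Finite
  pure : ∀ s ∈ K.faces, ∃ t ∈ K.faces, s ⊆ t ∧ t.card = 4

open scoped Classical in
/-- The (pairwise) Delaunay condition: whenever two tetrahedra `l`, `r` of the mesh share a
triangle, the vertex of `r` opposite to that triangle is not strictly inside the circumsphere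
of `l`. -/
def IsDelaunayMesh (K : Geometry.SimplicialComplex ℝ (EuclideanSpace ℝ (Fin 3))) : Prop :=
  ∀ l ∈ K.faces, ∀ r ∈ K.faces, l.card = 4 → r.card = 4 → (l ∩ r).card = 3 →
    ∀ x ∈ r, x ∉ l → x ∉ Metric.ball (finsetCircumsphere l).center (finsetCircumsphere l).radius

/-- `v` is an internal vertex of the mesh: a vertex not on the boundary of the meshed domain. -/
def IsInternalVertex (K : Geometry.SimplicialComplex ℝ (EuclideanSpace ℝ (Fin 3)))
    (v : EuclideanSpace ℝ (Fin 3)) : Prop :=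
  v ∈ K.vertices ∧ v ∈ interior K.space

/-- The full flags `{v} = F 0 ≺ F 1 ≺ F 2 ≺ F 3` of simplices of `K` that start at the vertex `v`
(`F i` has dimension `i`). They index the elementary dual simplices of `v`. -/
def flagsAt (K : Geometry.SimplicialComplex ℝ (EuclideanSpace ℝ (Fin 3)))
    (v : EuclideanSpace ℝ (Fin 3)) : Set (Fin 4 → Finset (EuclideanSpace ℝ (Fin 3))) :=
  {F | F 0 = {v} ∧ Monotone F ∧ ∀ i, F i ∈ K.faces ∧ (F i).card = (i : ℕ) + 1}

/-- The elementary dual simplex of a flag: its vertices are the circumcenters of the members. -/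
noncomputable def elementaryDual (F : Fin 4 → Finset (EuclideanSpace ℝ (Fin 3))) :
    Set (EuclideanSpace ℝ (Fin 3)) :=
  convexHull ℝ (Set.range fun i => (finsetCircumsphere (F i)).center)

open scoped Classical in
/-- The sign `s_i` of a pair of consecutive members `s ≺ t` of a flag: `+1` if the circumcenter
of `t` is in the same (open) half space relative to `s` as the vertex `w` of `t` opposite to `s`,
and `-1` otherwise. Both points lie in the affine hull of `t`. -/
noncomputable def stepSign (s t : Finset (EuclideanSpace ℝ (Fin 3))) : ℝ :=
  if ∃ w ∈ t, w ∉ s ∧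
      (affineSpan ℝ (s : Set (EuclideanSpace ℝ (Fin 3)))).SSameSide w (finsetCircumsphere t).center
  then 1 else -1

/-- The sign of an elementary dual simplex: the product of the signs of the steps of its flag. -/
noncomputable def elementarySign (F : Fin 4 → Finset (EuclideanSpace ℝ (Fin 3))) : ℝ :=
  ∏ i : Fin 3, stepSign (F i.castSucc) (F i.succ)

/-- The signed volume of the circumcentric dual cell of the vertex `v`: the sum of the signed
volumes of its elementary dual simplices. -/
noncomputable def signedDualVolume (K : Geometry.SimplicialComplex ℝ (EuclideanSpace ℝ (Fin 3)))
    (v : EuclideanSpace ℝ (Fin 3)) : ℝ :=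
  ∑ᶠ F ∈ flagsAt K v,
    elementarySign F * (MeasureTheory.volume (elementaryDual F)).toReal

/-!
Put `v` at the origin. The flags at `v` are the ordered triples `(a, b, c)` of edge vectors of the
tetrahedra at `v`, with circumcenter `C`. An elementary dual simplex is an affine image of a fixed
tetrahedron, so its signed volume is, up to a positive constant,
`‖a‖ ^ 2 * (‖b‖ ^ 2 - ⟪a, b⟫) / gram a b * height a b c`, where `height` is the signed length of the
dual edge of the triangle `a, b` inside the tetrahedron, times the area `√(gram a b)`
(`elementary_signed_volume`). Since `v` is internal, the cones of the tetrahedra form a complete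
simplicial fan (`delaunayFan_of_isInternalVertex`), and each of its walls lies in exactly two cones,
on opposite sides (`exists_mirror_map`).

The positivity of the sum (`dual_sum_pos`) has the following ingredients.

* The Delaunay condition says that the two heights at a wall have a nonnegative sum
  (`height_add_height_nonneg`), that is, that the piecewise linear function `x ↦ ⟪C, x⟫` (with `C`
  the center of the cone that contains `x`) is convex across walls. A walk along a generic segment
  (`exists_cone_of_crossing`) turns this into global convexity: `2 * ⟪C, a⟫ ≤ ‖a‖ ^ 2` for all
  edges `a` and all centers `C` (`two_mul_inner_center_le`).
* The edges of the dual polygon of `a`, turned by a right angle, add up to zero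
  (`sum_inner_mul_height_eq_zero`). Hence its signed area may be computed from any base point, and
  from the center of a tetrahedron at `a` all its sides are seen at nonnegative distances. So all
  these areas, and with them the sum, are nonnegative.
* If the sum vanished, so would all the areas, and `‖a‖ ^ 2` could be replaced by `‖a‖` in the sum.
  Averaging the terms of `(a, b, c)` and `(b, a, c)` then gives a sum of the lengths of the dual
  edges with weights that are all positive. All dual edges would be points and
  all centers would coincide, which is impossible in a complete fan (`exists_center_ne`).
-/

open Filter Topology

/-! ### Determinants and Gram determinants -/

/-- Euclidean three-space. -/
abbrev E3 := EuclideanSpace ℝ (Fin 3)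

/-- The determinant of three vectors, in the standard coordinates. -/
noncomputable def det3 (a b c : E3) : ℝ :=
  a 0 * (b 1 * c 2 - b 2 * c 1) - a 1 * (b 0 * c 2 - b 2 * c 0) + a 2 * (b 0 * c 1 - b 1 * c 0)

/-- The Gram determinant of two vectors, that is, the square of the area of the parallelogram
they span. -/
noncomputable def gram (a b : E3) : ℝ := inner ℝ a a * inner ℝ b b - inner ℝ a b ^ 2

theorem inner_eq_coord (a b : E3) : inner ℝ a b = a 0 * b 0 + a 1 * b 1 + a 2 * b 2 := by
  simp [PiLp.inner_apply, Fin.sum_univ_three]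
  ring

theorem gram_comm (a b : E3) : gram a b = gram b a := by
  simp only [gram, inner_eq_coord]; ring

theorem det3_swap₁₂ (a b c : E3) : det3 b a c = -det3 a b c := by
  simp only [det3]; ring

theorem det3_swap₂₃ (a b c : E3) : det3 a c b = -det3 a b c := by
  simp only [det3]; ring

theorem det3_comb (a b c : E3) (x y z : ℝ) (u w : E3) :
    det3 u w (x • a + y • b + z • c) = x * det3 u w a + y * det3 u w b + z * det3 u w c := by
  simp only [det3, PiLp.add_apply, PiLp.smul_apply, smul_eq_mul]; ring

theorem det3_self_left (a b : E3) : det3 a b a = 0 := by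
  simp only [det3]; ring

theorem det3_self_right (a b : E3) : det3 a b b = 0 := by
  simp only [det3]; ring

/-- Cramer's rule. -/
theorem cramer (a b c x : E3) (h : det3 a b c ≠ 0) :
    x = (det3 b c x / det3 a b c) • a + (det3 c a x / det3 a b c) • b
      + (det3 a b x / det3 a b c) • c := by
  have key : ∀ i : Fin 3, det3 a b c * x i
      = det3 b c x * a i + det3 c a x * b i + det3 a b x * c i := by
    intro i
    fin_cases i <;> simp [det3] <;> ring
  ext i
  simp only [PiLp.add_apply, PiLp.smul_apply, smul_eq_mul]
  field_simp
  linarith [key i]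

theorem continuous_det3 (a b : E3) : Continuous (fun x : E3 => det3 a b x) := by
  unfold det3; fun_prop

/-- The Gram determinant is the squared norm of the cross product; the third vector only serves
as a witness of linear independence. -/
theorem gram_pos_of_det3_ne_zero {a b c : E3} (h : det3 a b c ≠ 0) : 0 < gram a b := by
  have e : gram a b = (a 1 * b 2 - a 2 * b 1) ^ 2 + (a 2 * b 0 - a 0 * b 2) ^ 2
      + (a 0 * b 1 - a 1 * b 0) ^ 2 := by
    simp only [gram, inner_eq_coord]; ring
  rw [e]
  have q1 := sq_nonneg (a 1 * b 2 - a 2 * b 1)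
  have q2 := sq_nonneg (a 2 * b 0 - a 0 * b 2)
  have q3 := sq_nonneg (a 0 * b 1 - a 1 * b 0)
  by_contra hn
  have h1 : a 1 * b 2 - a 2 * b 1 = 0 := pow_eq_zero_iff two_ne_zero |>.1 (by linarith)
  have h2 : a 2 * b 0 - a 0 * b 2 = 0 := pow_eq_zero_iff two_ne_zero |>.1 (by linarith)
  have h3 : a 0 * b 1 - a 1 * b 0 = 0 := pow_eq_zero_iff two_ne_zero |>.1 (by linarith)
  apply h
  have : det3 a b c = (a 1 * b 2 - a 2 * b 1) * c 0 + (a 2 * b 0 - a 0 * b 2) * c 1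
      + (a 0 * b 1 - a 1 * b 0) * c 2 := by simp only [det3]; ring
  rw [this, h1, h2, h3]; ring

theorem inner_self_pos_of_det3_ne_zero {a b c : E3} (h : det3 a b c ≠ 0) :
    0 < inner ℝ a a := by
  refine real_inner_self_pos.2 ?_
  rintro rfl
  simp [det3] at h

/-- A vector `w` orthogonal to `a` and `b` is a multiple of the cross product of `a` and `b`. -/
theorem gram_mul_inner_of_orthogonal (a b w x : E3) (ha : inner ℝ w a = 0)
    (hb : inner ℝ w b = 0) : gram a b * inner ℝ w x = det3 a b w * det3 a b x := by
  have : gram a b * inner ℝ w x - det3 a b w * det3 a b x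
      = inner ℝ w a * (inner ℝ b b * inner ℝ a x - inner ℝ a b * inner ℝ b x)
        + inner ℝ w b * (inner ℝ a a * inner ℝ b x - inner ℝ a b * inner ℝ a x) := by
    simp only [gram, det3, inner_eq_coord]; ring
  rw [ha, hb] at this
  linarith

/-- The planar identity `u ⟪w, J u⟫ = J u ⟪w, u⟫ - J w` for a unit vector `u` and the quarter
turn `J`, in the plane orthogonal to `a`, written without normalisation. -/
theorem inner_mul_det3_of_orthogonal (a b w o : E3) (h : inner ℝ o a = 0) :
    inner ℝ a a * (inner ℝ o b * det3 a b w)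
      = det3 a b o * (inner ℝ w b * inner ℝ a a - inner ℝ w a * inner ℝ a b)
        - gram a b * det3 a w o := by
  have : inner ℝ a a * (inner ℝ o b * det3 a b w)
      - (det3 a b o * (inner ℝ w b * inner ℝ a a - inner ℝ w a * inner ℝ a b)
        - gram a b * det3 a w o) = inner ℝ o a * (inner ℝ a b * det3 a b w) := by
    simp only [gram, det3, inner_eq_coord]; ring
  rw [h] at this
  linarith

theorem sign_eq_neg_of_mul_neg {x y : ℝ} (h : x * y < 0) : Real.sign y = -Real.sign x := by
  rcases mul_neg_iff.1 h with ⟨h1, h2⟩ | ⟨h1, h2⟩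
  · rw [Real.sign_of_pos h1, Real.sign_of_neg h2]
  · rw [Real.sign_of_neg h1, Real.sign_of_pos h2, neg_neg]

theorem eventually_nonneg_add_mul {α : ℝ} (h : 0 < α) (α' : ℝ) :
    ∀ᶠ ε in 𝓝[>] (0 : ℝ), 0 ≤ α + ε * α' := by
  have : Continuous (fun ε : ℝ => α + ε * α') := by fun_prop
  have h2 := this.tendsto 0
  simp only [zero_mul, add_zero] at h2
  exact ((h2.mono_left nhdsWithin_le_nhds).eventually (lt_mem_nhds h)).mono fun _ h => h.le

/-! ### Complete simplicial fans -/

/-- The closed simplicial cone spanned by three vectors. -/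
def cone3 (a b c : E3) : Set E3 :=
  {x | ∃ α β γ : ℝ, 0 ≤ α ∧ 0 ≤ β ∧ 0 ≤ γ ∧ x = α • a + β • b + γ • c}

theorem cone3_swap₁₂ (a b c : E3) : cone3 b a c = cone3 a b c := by
  ext x
  constructor <;> rintro ⟨α, β, γ, hα, hβ, hγ, rfl⟩ <;>
    exact ⟨β, α, γ, hβ, hα, hγ, by abel⟩

theorem cone3_swap₂₃ (a b c : E3) : cone3 a c b = cone3 a b c := by
  ext x
  constructor <;> rintro ⟨α, β, γ, hα, hβ, hγ, rfl⟩ <;>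
    exact ⟨α, γ, β, hα, hγ, hβ, by abel⟩

theorem cone3_eq_of_det3_ne_zero {a b c : E3} (h : det3 a b c ≠ 0) :
    cone3 a b c = {x | 0 ≤ det3 b c x / det3 a b c ∧ 0 ≤ det3 c a x / det3 a b c
      ∧ 0 ≤ det3 a b x / det3 a b c} := by
  ext x
  constructor
  · rintro ⟨α, β, γ, hα, hβ, hγ, rfl⟩
    have e1 : det3 b c (α • a + β • b + γ • c) / det3 a b c = α := by
      rw [div_eq_iff h]
      simp only [det3, PiLp.add_apply, PiLp.smul_apply, smul_eq_mul]; ring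
    have e2 : det3 c a (α • a + β • b + γ • c) / det3 a b c = β := by
      rw [div_eq_iff h]
      simp only [det3, PiLp.add_apply, PiLp.smul_apply, smul_eq_mul]; ring
    have e3 : det3 a b (α • a + β • b + γ • c) / det3 a b c = γ := by
      rw [div_eq_iff h]
      simp only [det3, PiLp.add_apply, PiLp.smul_apply, smul_eq_mul]; ring
    simp only [Set.mem_ofPred_eq, e1, e2, e3]
    exact ⟨hα, hβ, hγ⟩
  · rintro ⟨h1, h2, h3⟩
    exact ⟨_, _, _, h1, h2, h3, cramer a b c x h⟩

theorem isClosed_cone3 {a b c : E3} (h : det3 a b c ≠ 0) : IsClosed (cone3 a b c) := by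
  rw [cone3_eq_of_det3_ne_zero h]
  refine IsClosed.inter ?_ (IsClosed.inter ?_ ?_)
  · exact isClosed_le continuous_const ((continuous_det3 b c).div_const _)
  · exact isClosed_le continuous_const ((continuous_det3 c a).div_const _)
  · exact isClosed_le continuous_const ((continuous_det3 a b).div_const _)

/-- A simplicial cone avoids any finite family of planes through the origin, at some point. -/
theorem exists_mem_cone3_notMem_span {a b c : E3} (h : det3 a b c ≠ 0) (x : E3)
    (A : Finset E3) : ∃ y ∈ cone3 a b c, ∀ w ∈ A, y ∉ Submodule.span ℝ {x, w} := by
  set U : Set E3 := {z | 0 < det3 b c z / det3 a b c} ∩ ({z | 0 < det3 c a z / det3 a b c}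
      ∩ {z | 0 < det3 a b z / det3 a b c}) with hU
  have hUo : IsOpen U := by
    refine IsOpen.inter ?_ (IsOpen.inter ?_ ?_)
    · exact isOpen_lt continuous_const ((continuous_det3 b c).div_const _)
    · exact isOpen_lt continuous_const ((continuous_det3 c a).div_const _)
    · exact isOpen_lt continuous_const ((continuous_det3 a b).div_const _)
  have hUn : U.Nonempty := by
    refine ⟨a + b + c, ?_, ?_, ?_⟩
    · have : det3 b c (a + b + c) = det3 a b c := by
        simp only [det3, PiLp.add_apply]; ring
      simp [this, h]
    · have : det3 c a (a + b + c) = det3 a b c := by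
        simp only [det3, PiLp.add_apply]; ring
      simp [this, h]
    · have : det3 a b (a + b + c) = det3 a b c := by
        simp only [det3, PiLp.add_apply]; ring
      simp [this, h]
  have hpos : 0 < MeasureTheory.volume U := hUo.measure_pos _ hUn
  have hnull : MeasureTheory.volume (⋃ w ∈ A, (Submodule.span ℝ {x, w} : Set E3)) = 0 := by
    refine (MeasureTheory.measure_biUnion_null_iff A.countable_toSet).2 fun w _ => ?_
    apply MeasureTheory.Measure.addHaar_submodule
    intro htop
    have h1 : Module.finrank ℝ (Submodule.span ℝ ({x, w} : Set E3)) ≤ 2 := by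
      classical
      have := finrank_span_finset_le_card (R := ℝ) ({x, w} : Finset E3)
      rw [Finset.coe_pair] at this
      exact this.trans Finset.card_le_two
    rw [htop, finrank_top] at h1
    simp at h1
  have : ¬ U ⊆ ⋃ w ∈ A, (Submodule.span ℝ {x, w} : Set E3) := fun hs =>
    absurd (MeasureTheory.measure_mono_null hs hnull) hpos.ne'
  obtain ⟨y, hy, hn⟩ := Set.not_subset.1 this
  refine ⟨y, ?_, fun w hw hyw => hn (Set.mem_biUnion (Finset.mem_coe.2 hw) hyw)⟩
  rw [cone3_eq_of_det3_ne_zero h]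
  exact ⟨hy.1.le, hy.2.1.le, hy.2.2.le⟩

/-- A finite complete simplicial fan in `ℝ³`, with a vector attached to each maximal cone, modelled
on the star of an internal vertex of a Delaunay mesh. The maximal cones are given by the ordered
triples of edge vectors that span them, so `S` contains with a triple all its permutations; `C a b c`
is the circumcenter of the tetrahedron `0, a, b, c`, of which only `inner_center` is recorded.
The field `inter` says that two cones meet in a common face: a point of both has positive
coordinates in one of them only along edges of the other. -/
structure DelaunayFan (S : Finset (E3 × E3 × E3)) (C : E3 → E3 → E3 → E3) : Prop where
  swap₁₂ : ∀ {a b c}, (a, b, c) ∈ S → (b, a, c) ∈ S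
  swap₂₃ : ∀ {a b c}, (a, b, c) ∈ S → (a, c, b) ∈ S
  det_ne : ∀ {a b c}, (a, b, c) ∈ S → det3 a b c ≠ 0
  cover : ∀ x, ∃ a b c, (a, b, c) ∈ S ∧ x ∈ cone3 a b c
  inter : ∀ {a b c a' b' c'}, (a, b, c) ∈ S → (a', b', c') ∈ S → ∀ α β γ : ℝ, 0 ≤ α → 0 ≤ β →
    0 < γ → α • a + β • b + γ • c ∈ cone3 a' b' c' → c = a' ∨ c = b' ∨ c = c'
  center_swap₁₂ : ∀ a b c, C b a c = C a b c
  center_swap₂₃ : ∀ a b c, C a c b = C a b c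
  inner_center : ∀ {a b c}, (a, b, c) ∈ S → 2 * inner ℝ (C a b c) a = inner ℝ a a
  delaunay : ∀ {a b c c'}, (a, b, c) ∈ S → (a, b, c') ∈ S → c ≠ c' →
    2 * inner ℝ (C a b c) c' ≤ inner ℝ c' c'

namespace DelaunayFan

variable {S : Finset (E3 × E3 × E3)} {C : E3 → E3 → E3 → E3}

theorem swap₁₃ (hF : DelaunayFan S C) {a b c : E3} (h : (a, b, c) ∈ S) : (c, b, a) ∈ S :=
  hF.swap₁₂ (hF.swap₂₃ (hF.swap₁₂ h))

/-- A point close to `y` lies in a cone that contains `y`. -/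
theorem eventually_common_cone (hF : DelaunayFan S C) (y : E3) :
    ∀ᶠ x in 𝓝 y, ∃ a b c, (a, b, c) ∈ S ∧ x ∈ cone3 a b c ∧ y ∈ cone3 a b c := by
  have h : ∀ᶠ x in 𝓝 y, ∀ p ∈ S, y ∉ cone3 p.1 p.2.1 p.2.2 → x ∉ cone3 p.1 p.2.1 p.2.2 := by
    rw [Filter.eventually_all_finset]
    intro p hp
    by_cases hy : y ∈ cone3 p.1 p.2.1 p.2.2
    · exact Filter.Eventually.of_forall fun x hn => absurd hy hn
    · filter_upwards [(isClosed_cone3 (hF.det_ne hp)).isOpen_compl.mem_nhds hy] with x hx _ using hx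
  filter_upwards [h] with x hx
  obtain ⟨a, b, c, hS, hxc⟩ := hF.cover x
  exact ⟨a, b, c, hS, hxc, by_contra fun hy => hx _ hS hy hxc⟩

theorem exists_reorder (hF : DelaunayFan S C) {a b c x y : E3} (h : (a, b, c) ∈ S)
    (hxy : x ≠ y) (hx : x = a ∨ x = b ∨ x = c) (hy : y = a ∨ y = b ∨ y = c) :
    ∃ z, (x, y, z) ∈ S ∧ cone3 x y z = cone3 a b c := by
  rcases hx with rfl | rfl | rfl <;> rcases hy with rfl | rfl | rfl
  · exact absurd rfl hxy
  · exact ⟨c, h, rfl⟩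
  · exact ⟨b, hF.swap₂₃ h, cone3_swap₂₃ _ _ _⟩
  · exact ⟨c, hF.swap₁₂ h, cone3_swap₁₂ _ _ _⟩
  · exact absurd rfl hxy
  · exact ⟨a, hF.swap₂₃ (hF.swap₁₂ h), by rw [cone3_swap₂₃, cone3_swap₁₂]⟩
  · exact ⟨b, hF.swap₁₂ (hF.swap₂₃ h), by rw [cone3_swap₁₂, cone3_swap₂₃]⟩
  · exact ⟨a, hF.swap₁₃ h, by rw [cone3_swap₁₂, cone3_swap₂₃, cone3_swap₁₂]⟩
  · exact absurd rfl hxy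

/-- Each wall lies in a cone on its other side. -/
theorem exists_mirror (hF : DelaunayFan S C) {a b c : E3} (h : (a, b, c) ∈ S) :
    ∃ c', (a, b, c') ∈ S ∧ det3 a b c * det3 a b c' < 0 := by
  have hd := hF.det_ne h
  have ht : Tendsto (fun ε : ℝ => a + b - ε • c) (𝓝[>] 0) (𝓝 (a + b)) := by
    have : Continuous (fun ε : ℝ => a + b - ε • c) := by fun_prop
    have h2 := this.tendsto 0
    simp only [zero_smul, sub_zero] at h2
    exact h2.mono_left nhdsWithin_le_nhds
  obtain ⟨ε, ⟨u, v, w, hS, hx, hy⟩, hε⟩ :=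
    ((ht.eventually (hF.eventually_common_cone (a + b))).and self_mem_nhdsWithin).exists
  have hε : 0 < ε := hε
  have hab : a ≠ b := by
    rintro rfl
    exact hd (by simp only [det3]; ring)
  have ha : a = u ∨ a = v ∨ a = w := by
    refine hF.inter (hF.swap₁₃ h) hS 0 1 1 le_rfl zero_le_one zero_lt_one ?_
    convert hy using 1
    module
  have hb : b = u ∨ b = v ∨ b = w := by
    refine hF.inter (hF.swap₂₃ h) hS 1 0 1 zero_le_one le_rfl zero_lt_one ?_
    convert hy using 1
    module
  obtain ⟨c', hc', e⟩ := hF.exists_reorder hS hab ha hb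
  refine ⟨c', hc', ?_⟩
  rw [← e] at hx
  obtain ⟨α, β, γ, -, -, hγ, hx⟩ := hx
  have e2 : det3 a b (a + b - ε • c) = -(ε * det3 a b c) := by
    simp only [det3, PiLp.add_apply, PiLp.sub_apply, PiLp.smul_apply, smul_eq_mul]; ring
  rw [hx, det3_comb, det3_self_left, det3_self_right] at e2
  have e3 : γ * (det3 a b c * det3 a b c') = -(ε * det3 a b c ^ 2) := by
    linear_combination det3 a b c * e2
  have e4 : γ * (det3 a b c * det3 a b c') < 0 := by
    rw [e3]
    linarith [mul_pos hε (sq_pos_of_ne_zero hd)]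
  by_contra hn
  exact absurd (mul_nonneg hγ (not_lt.1 hn)) (not_le.2 e4)

theorem eq_of_same_side (hF : DelaunayFan S C) {a b c c' : E3} (h : (a, b, c) ∈ S)
    (h' : (a, b, c') ∈ S) (hs : 0 < det3 a b c * det3 a b c') : c = c' := by
  have hd := hF.det_ne h
  have hd' := hF.det_ne h'
  have key := cramer a b c' c hd'
  set x := det3 b c' c / det3 a b c'
  set y := det3 c' a c / det3 a b c'
  set z := det3 a b c / det3 a b c' with hz
  have hzp : 0 ≤ z := by
    rw [hz, div_eq_mul_inv, ← mul_self_mul_inv (det3 a b c')⁻¹, inv_inv]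
    have := mul_self_nonneg (det3 a b c')⁻¹
    nlinarith
  have hx : 0 ≤ 1 + |x| + x := by linarith [neg_abs_le x]
  have hy : 0 ≤ 1 + |y| + y := by linarith [neg_abs_le y]
  have hm : (1 + |x|) • a + (1 + |y|) • b + (1 : ℝ) • c ∈ cone3 a b c' := by
    refine ⟨1 + |x| + x, 1 + |y| + y, z, hx, hy, hzp, ?_⟩
    rw [key]
    module
  rcases hF.inter h h' _ _ _ (by positivity) (by positivity) zero_lt_one hm with rfl | rfl | rfl
  · exact absurd (det3_self_left _ _) hd
  · exact absurd (det3_self_right _ _) hd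
  · rfl

/-- Crossing a wall does not change the center in the direction of the wall, and the Delaunay
condition says that it changes convexly in the transversal direction. -/
theorem inner_center_le (hF : DelaunayFan S C) {a b c c' x : E3} (h : (a, b, c) ∈ S)
    (h' : (a, b, c') ∈ S) (hs : det3 a b c * det3 a b c' < 0) (hx : 0 ≤ det3 a b c' * det3 a b x) :
    inner ℝ (C a b c) x ≤ inner ℝ (C a b c') x := by
  have hne : c ≠ c' := by rintro rfl; nlinarith
  have hD := hF.delaunay h h' hne
  have g := gram_pos_of_det3_ne_zero (hF.det_ne h)
  have ca : ∀ {u v w}, (u, v, w) ∈ S → 2 * inner ℝ (C u v w) v = inner ℝ v v := fun hw => by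
    rw [← hF.center_swap₁₂]; exact hF.inner_center (hF.swap₁₂ hw)
  have cc : 2 * inner ℝ (C a b c') c' = inner ℝ c' c' := by
    rw [← hF.center_swap₂₃]; exact ca (hF.swap₂₃ h')
  have ha : inner ℝ (C a b c' - C a b c) a = 0 := by
    rw [inner_sub_left]; linarith [hF.inner_center h, hF.inner_center h']
  have hb : inner ℝ (C a b c' - C a b c) b = 0 := by
    rw [inner_sub_left]; linarith [ca h, ca h']
  have k1 := gram_mul_inner_of_orthogonal a b _ c' ha hb
  have k2 := gram_mul_inner_of_orthogonal a b _ x ha hb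
  have h1 : 0 ≤ det3 a b (C a b c' - C a b c) * det3 a b c' := by
    rw [← k1, inner_sub_left]
    exact mul_nonneg g.le (by linarith)
  have hd' : 0 < det3 a b c' ^ 2 := sq_pos_of_ne_zero (hF.det_ne h')
  have h2 : 0 ≤ gram a b * inner ℝ (C a b c' - C a b c) x := by
    rw [k2]
    have := mul_nonneg h1 hx
    by_contra hn
    nlinarith
  have h3 := nonneg_of_mul_nonneg_right h2 g
  rw [inner_sub_left] at h3
  linarith

/-- A point of a cone off the two walls through `c` may be moved a little towards `x` inside the
cone or inside its neighbour across the wall spanned by `a` and `b`. -/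
theorem eventually_step (hF : DelaunayFan S C) (P : E3 → Prop) (x : E3)
    (hstep : ∀ a b c c', (a, b, c) ∈ S → (a, b, c') ∈ S → det3 a b c * det3 a b c' < 0 →
      0 ≤ det3 a b c' * det3 a b x → P (C a b c) → P (C a b c'))
    {a b c d : E3} (h : (a, b, c) ∈ S) (hP : P (C a b c)) {α β γ r : ℝ} (hα : 0 < α)
    (hβ : 0 < β) (hγ : 0 ≤ γ) (hr : 0 < r) (hx : x = α • a + β • b + γ • c + r • d) :
    ∀ᶠ ε in 𝓝[>] (0 : ℝ), ∃ a' b' c', (a', b', c') ∈ S ∧ P (C a' b' c') ∧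
      α • a + β • b + γ • c + ε • d ∈ cone3 a' b' c' := by
  have hd := hF.det_ne h
  have inside : ∀ c', (a, b, c') ∈ S → P (C a b c') →
      α • a + β • b + γ • c = α • a + β • b + γ • c' →
      (0 < γ ∨ 0 ≤ det3 a b d / det3 a b c') →
      ∀ᶠ ε in 𝓝[>] (0 : ℝ), ∃ a' b' c', (a', b', c') ∈ S ∧ P (C a' b' c') ∧
      α • a + β • b + γ • c + ε • d ∈ cone3 a' b' c' := by
    intro c' hc' hP' e hor
    have key := cramer a b c' d (hF.det_ne hc')
    set u := det3 b c' d / det3 a b c'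
    set v := det3 c' a d / det3 a b c'
    set w := det3 a b d / det3 a b c'
    have hw : ∀ᶠ ε in 𝓝[>] (0 : ℝ), 0 ≤ γ + ε * w := by
      rcases hor with h1 | h1
      · exact eventually_nonneg_add_mul h1 w
      · filter_upwards [self_mem_nhdsWithin] with ε hε
        have hε : 0 < ε := hε
        positivity
    filter_upwards [eventually_nonneg_add_mul hα u, eventually_nonneg_add_mul hβ v, hw]
      with ε h1 h2 h3
    refine ⟨a, b, c', hc', hP', _, _, _, h1, h2, h3, ?_⟩
    rw [e, key]
    module
  by_cases h1 : 0 < γ ∨ 0 ≤ det3 a b d / det3 a b c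
  · exact inside c h hP rfl h1
  · push Not at h1
    obtain rfl : γ = 0 := le_antisymm h1.1 hγ
    obtain ⟨c', hc', hs⟩ := hF.exists_mirror h
    have hd' := hF.det_ne hc'
    have hq : det3 a b c * det3 a b d < 0 := by
      have := mul_neg_of_neg_of_pos h1.2 (sq_pos_of_ne_zero hd)
      rwa [div_mul_eq_mul_div, sq, mul_div_assoc, mul_self_div_self, mul_comm] at this
    have hq' : 0 < det3 a b c' * det3 a b d := by
      have := mul_pos_of_neg_of_neg hs hq
      have h3 := sq_pos_of_ne_zero hd
      by_contra hn
      nlinarith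
    have ex : det3 a b x = r * det3 a b d := by
      rw [hx]
      simp only [det3, PiLp.add_apply, PiLp.smul_apply, smul_eq_mul]; ring
    refine inside c' hc' (hstep a b c c' h hc' hs ?_ hP) (by simp) (Or.inr ?_)
    · rw [ex]
      have := mul_pos hr hq'
      linarith
    · have := div_pos hq' (sq_pos_of_ne_zero hd')
      rw [sq, mul_div_mul_left _ _ hd'] at this
      exact this.le

/-- A walk through the fan along a segment. A property of the centers that survives the crossing of
walls towards `x` passes from any maximal cone to one that contains `x`: the segment to `x` from
a generic point of the given cone meets the two-dimensional walls only in their relative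
interiors. -/
theorem exists_cone_of_crossing (hF : DelaunayFan S C) (P : E3 → Prop) (x : E3)
    (hstep : ∀ a b c c', (a, b, c) ∈ S → (a, b, c') ∈ S → det3 a b c * det3 a b c' < 0 →
      0 ≤ det3 a b c' * det3 a b x → P (C a b c) → P (C a b c'))
    {a₀ b₀ c₀ : E3} (h₀ : (a₀, b₀, c₀) ∈ S) (hP₀ : P (C a₀ b₀ c₀)) :
    ∃ a b c, (a, b, c) ∈ S ∧ P (C a b c) ∧ x ∈ cone3 a b c := by
  classical
  obtain ⟨y, hy, hgen⟩ := exists_mem_cone3_notMem_span (hF.det_ne h₀) x (S.image Prod.fst)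
  have hgen' : ∀ {a b c : E3}, (a, b, c) ∈ S → ∀ t α : ℝ, t < 1 → y + t • (x - y) ≠ α • a := by
    intro a b c h t α ht e
    refine hgen a (Finset.mem_image_of_mem Prod.fst h) ?_
    rw [Submodule.mem_span_pair]
    have h1 : 1 - t ≠ 0 := by linarith
    refine ⟨-(t / (1 - t)), α / (1 - t), ?_⟩
    have : (1 - t) • y = α • a - t • x := by rw [← e]; module
    rw [← inv_smul_smul₀ h1 y, this]
    module
  set s : Set ℝ := {t | ∃ a b c, (a, b, c) ∈ S ∧ P (C a b c) ∧ y + t • (x - y) ∈ cone3 a b c}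
    with hs
  have hcl : IsClosed s := by
    have e : s = ⋃ p ∈ {p ∈ (S : Set (E3 × E3 × E3)) | P (C p.1 p.2.1 p.2.2)},
        (fun t : ℝ => y + t • (x - y)) ⁻¹' cone3 p.1 p.2.1 p.2.2 := by
      ext t
      simp [hs, and_assoc]
    rw [e]
    refine (S.finite_toSet.subset (Set.sep_subset _ _)).isClosed_biUnion fun p hp => ?_
    exact (isClosed_cone3 (hF.det_ne hp.1)).preimage (by fun_prop)
  have hsub : Set.Icc (0 : ℝ) 1 ⊆ s := by
    refine IsClosed.Icc_subset_of_forall_exists_gt (hcl.inter isClosed_Icc) ?_ ?_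
    · exact ⟨a₀, b₀, c₀, h₀, hP₀, by simpa using hy⟩
    · rintro t ⟨⟨a, b, c, h, hP, α, β, γ, hα, hβ, hγ, e⟩, ht0, ht1⟩ z hz
      have hz : t < z := hz
      have step : ∀ {a b c : E3} {α β γ : ℝ}, (a, b, c) ∈ S → P (C a b c) → 0 < α → 0 < β →
          0 ≤ γ → y + t • (x - y) = α • a + β • b + γ • c → (s ∩ Set.Ioc t z).Nonempty := by
        intro a b c α β γ h hP hα hβ hγ e
        have hev := hF.eventually_step P x hstep (d := x - y) (r := 1 - t) h hP hα hβ hγ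
          (by linarith) (by rw [← e]; module)
        have hsm : ∀ᶠ ε in 𝓝[>] (0 : ℝ), ε < z - t :=
          nhdsWithin_le_nhds (gt_mem_nhds (by linarith))
        obtain ⟨ε, ⟨⟨a', b', c', h', hP', hm⟩, h1⟩, h2⟩ :=
          ((hev.and hsm).and self_mem_nhdsWithin).exists
        have h2 : 0 < ε := h2
        refine ⟨t + ε, ⟨a', b', c', h', hP', ?_⟩, by linarith, by linarith⟩
        rw [← e] at hm
        convert hm using 1
        module
      rcases hα.eq_or_lt with rfl | hα'
      · rcases hβ.eq_or_lt with rfl | hβ'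
        · exact absurd (by rw [e]; module) (hgen' (hF.swap₁₃ h) t γ ht1)
        · rcases hγ.eq_or_lt with rfl | hγ'
          · exact absurd (by rw [e]; module) (hgen' (hF.swap₁₂ h) t β ht1)
          · refine step (hF.swap₁₃ h) ?_ hγ' hβ' le_rfl (by rw [e]; module)
            rwa [hF.center_swap₁₂, hF.center_swap₂₃, hF.center_swap₁₂]
      · rcases hβ.eq_or_lt with rfl | hβ'
        · rcases hγ.eq_or_lt with rfl | hγ'
          · exact absurd (by rw [e]; module) (hgen' h t α ht1)
          · refine step (hF.swap₂₃ h) ?_ hα' hγ' le_rfl (by rw [e]; module)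
            rwa [hF.center_swap₂₃]
        · exact step h hP hα' hβ' hγ e
  obtain ⟨a, b, c, h, hP, hm⟩ := hsub ⟨zero_le_one, le_rfl⟩
  exact ⟨a, b, c, h, hP, by simpa using hm⟩

/-! ### Heights and the closing condition -/

/-- The volume `|det3 a b C|` of the parallelepiped spanned by `a`, `b` and the center `C` of the
cone `a, b, c`, with a positive sign if `C` is on the same side of the wall spanned by `a` and `b`
as `c`. Divided by the area of the parallelogram spanned by `a` and `b` it is the signed length of
the part of the dual edge of the wall that belongs to this cone. -/
noncomputable def height (C : E3 → E3 → E3 → E3) (a b c : E3) : ℝ :=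
  Real.sign (det3 a b c) * det3 a b (C a b c)

theorem height_swap₁₂ (hF : DelaunayFan S C) (a b c : E3) : height C b a c = height C a b c := by
  rw [height, height, det3_swap₁₂ a b, det3_swap₁₂ a b, hF.center_swap₁₂, Real.sign_neg]
  ring

theorem inner_center₂ (hF : DelaunayFan S C) {a b c : E3} (h : (a, b, c) ∈ S) :
    2 * inner ℝ (C a b c) b = inner ℝ b b := by
  rw [← hF.center_swap₁₂]; exact hF.inner_center (hF.swap₁₂ h)

theorem sum_swap₁₂ (hF : DelaunayFan S C) (f : E3 → E3 → E3 → ℝ) :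
    ∑ p ∈ S, f p.2.1 p.1 p.2.2 = ∑ p ∈ S, f p.1 p.2.1 p.2.2 :=
  Finset.sum_nbij' (fun p => (p.2.1, p.1, p.2.2)) (fun p => (p.2.1, p.1, p.2.2))
    (fun _ h => hF.swap₁₂ h) (fun _ h => hF.swap₁₂ h) (fun _ _ => rfl) (fun _ _ => rfl)
    (fun _ _ => rfl)

theorem sum_swap₂₃ (hF : DelaunayFan S C) (f : E3 → E3 → E3 → ℝ) :
    ∑ p ∈ S, f p.1 p.2.2 p.2.1 = ∑ p ∈ S, f p.1 p.2.1 p.2.2 :=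
  Finset.sum_nbij' (fun p => (p.1, p.2.2, p.2.1)) (fun p => (p.1, p.2.2, p.2.1))
    (fun _ h => hF.swap₂₃ h) (fun _ h => hF.swap₂₃ h) (fun _ _ => rfl) (fun _ _ => rfl)
    (fun _ _ => rfl)

/-- Every wall lies in exactly two cones, one on each side. -/
theorem exists_mirror_map (hF : DelaunayFan S C) : ∃ m : E3 → E3 → E3 → E3, ∀ a b c,
    (a, b, c) ∈ S → (a, b, m a b c) ∈ S ∧ det3 a b c * det3 a b (m a b c) < 0 ∧
      m a b (m a b c) = c := by
  have h : ∀ a b c, ∃ c', (a, b, c) ∈ S → (a, b, c') ∈ S ∧ det3 a b c * det3 a b c' < 0 := by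
    intro a b c
    by_cases hS : (a, b, c) ∈ S
    · obtain ⟨c', hc'⟩ := hF.exists_mirror hS
      exact ⟨c', fun _ => hc'⟩
    · exact ⟨0, fun h => absurd h hS⟩
  choose m hm using h
  refine ⟨m, fun a b c hS => ⟨(hm a b c hS).1, (hm a b c hS).2, ?_⟩⟩
  obtain ⟨h1, h2⟩ := hm a b c hS
  obtain ⟨h3, h4⟩ := hm a b _ h1
  refine hF.eq_of_same_side h3 hS ?_
  have h5 := mul_pos_of_neg_of_neg h2 h4
  have h6 := sq_pos_of_ne_zero (hF.det_ne h1)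
  by_contra hn
  nlinarith

theorem sum_mirror {m : E3 → E3 → E3 → E3}
    (hm : ∀ a b c, (a, b, c) ∈ S → (a, b, m a b c) ∈ S ∧ det3 a b c * det3 a b (m a b c) < 0 ∧
      m a b (m a b c) = c) (f : E3 → E3 → E3 → ℝ) :
    ∑ p ∈ S, f p.1 p.2.1 (m p.1 p.2.1 p.2.2) = ∑ p ∈ S, f p.1 p.2.1 p.2.2 := by
  refine Finset.sum_nbij' (fun p => (p.1, p.2.1, m p.1 p.2.1 p.2.2))
    (fun p => (p.1, p.2.1, m p.1 p.2.1 p.2.2)) (fun p h => (hm _ _ _ h).1)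
    (fun p h => (hm _ _ _ h).1) (fun p h => ?_) (fun p h => ?_) (fun _ _ => rfl)
  · simp only [(hm p.1 p.2.1 p.2.2 h).2.2]
  · simp only [(hm p.1 p.2.1 p.2.2 h).2.2]

/-- Closing condition of the dual polygons: the edges of the dual face of `a`, turned by a right
angle in the plane orthogonal to `a`, add up to zero. It is tested against vectors `o a` of that
plane, and summed over `a` with weights. -/
theorem sum_inner_mul_height_eq_zero (hF : DelaunayFan S C) (w : E3 → ℝ) (o : E3 → E3)
    (ho : ∀ a, inner ℝ (o a) a = 0) :
    ∑ p ∈ S, w p.1 * (inner ℝ (o p.1) p.2.1 / gram p.1 p.2.1) * height C p.1 p.2.1 p.2.2 = 0 := by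
  obtain ⟨m, hm⟩ := hF.exists_mirror_map
  set X : E3 → E3 → E3 → ℝ := fun a b c => Real.sign (det3 a b c) *
    (w a * det3 a b (o a) * (inner ℝ b b - inner ℝ a b) / (2 * gram a b)) with hX
  set Y : E3 → E3 → E3 → ℝ := fun a b c => Real.sign (det3 a b c) *
    (w a * det3 a (C a b c) (o a) / inner ℝ a a) with hY
  have hX0 : ∑ p ∈ S, X p.1 p.2.1 p.2.2 = 0 := by
    have h1 := sum_mirror hm X
    have h2 : ∑ p ∈ S, X p.1 p.2.1 (m p.1 p.2.1 p.2.2) = -∑ p ∈ S, X p.1 p.2.1 p.2.2 := by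
      rw [← Finset.sum_neg_distrib]
      refine Finset.sum_congr rfl fun p hp => ?_
      rw [hX]
      simp only
      rw [sign_eq_neg_of_mul_neg (hm p.1 p.2.1 p.2.2 hp).2.1]
      ring
    linarith
  have hY0 : ∑ p ∈ S, Y p.1 p.2.1 p.2.2 = 0 := by
    have h1 := hF.sum_swap₂₃ Y
    have h2 : ∑ p ∈ S, Y p.1 p.2.2 p.2.1 = -∑ p ∈ S, Y p.1 p.2.1 p.2.2 := by
      rw [← Finset.sum_neg_distrib]
      refine Finset.sum_congr rfl fun p hp => ?_
      rw [hY]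
      simp only
      rw [det3_swap₂₃ p.1 p.2.1 p.2.2, hF.center_swap₂₃, Real.sign_neg]
      ring
    linarith
  have key : ∀ p ∈ S, w p.1 * (inner ℝ (o p.1) p.2.1 / gram p.1 p.2.1)
      * height C p.1 p.2.1 p.2.2 = X p.1 p.2.1 p.2.2 - Y p.1 p.2.1 p.2.2 := by
    rintro ⟨a, b, c⟩ hp
    have g := (gram_pos_of_det3_ne_zero (hF.det_ne hp)).ne'
    have q := (inner_self_pos_of_det3_ne_zero (hF.det_ne hp)).ne'
    have id1 := inner_mul_det3_of_orthogonal a b (C a b c) (o a) (ho a)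
    have e1 : inner ℝ (C a b c) a = inner ℝ a a / 2 := by linarith [hF.inner_center hp]
    have e2 : inner ℝ (C a b c) b = inner ℝ b b / 2 := by linarith [hF.inner_center₂ hp]
    rw [e1, e2] at id1
    simp only [hX, hY, height]
    field_simp
    linear_combination (2 * w a * Real.sign (det3 a b c)) * id1
  rw [Finset.sum_congr rfl key, Finset.sum_sub_distrib, hX0, hY0, sub_zero]

/-! ### Positivity for Delaunay fans -/

theorem inner_center_of_mem_cone3 (hF : DelaunayFan S C) {a b c u v w : E3}
    (h : (a, b, c) ∈ S) (h' : (u, v, w) ∈ S) (hm : a ∈ cone3 u v w) :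
    2 * inner ℝ (C u v w) a = inner ℝ a a := by
  have : a = u ∨ a = v ∨ a = w := by
    refine hF.inter (hF.swap₁₃ h) h' 0 0 1 le_rfl le_rfl zero_lt_one ?_
    convert hm using 1
    module
  rcases this with rfl | rfl | rfl
  · exact hF.inner_center h'
  · exact hF.inner_center₂ h'
  · rw [← hF.center_swap₂₃]; exact hF.inner_center₂ (hF.swap₂₃ h')

/-- Local convexity implies global convexity: no end point of an edge lies strictly inside the
circumsphere of a tetrahedron of the fan. -/
theorem two_mul_inner_center_le (hF : DelaunayFan S C) {a b c u v w : E3}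
    (h : (a, b, c) ∈ S) (h' : (u, v, w) ∈ S) :
    2 * inner ℝ (C u v w) a ≤ inner ℝ a a := by
  obtain ⟨x, y, z, hS, hP, hm⟩ := hF.exists_cone_of_crossing
    (fun p => inner ℝ (C u v w) a ≤ inner ℝ p a) a
    (fun _ _ _ _ h1 h2 hs hx hp => hp.trans (hF.inner_center_le h1 h2 hs hx)) h' le_rfl
  rw [← hF.inner_center_of_mem_cone3 h hS hm]
  linarith

/-- The center of a tetrahedron at the edge `a` gives a point, here relative to the midpoint of the
edge, from which the dual polygon of `a` is seen with nonnegative distances to all its sides. -/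
theorem exists_polygon_point (hF : DelaunayFan S C) (a : E3) : ∃ o : E3, inner ℝ o a = 0 ∧
    ∀ b c, (a, b, c) ∈ S → 2 * inner ℝ o b ≤ inner ℝ b b - inner ℝ a b := by
  by_cases h : ∃ b c, (a, b, c) ∈ S
  · obtain ⟨b, c, h⟩ := h
    refine ⟨C a b c - (1 / 2 : ℝ) • a, ?_, fun b' c' h' => ?_⟩
    · rw [inner_sub_left, real_inner_smul_left]
      linarith [hF.inner_center h]
    · rw [inner_sub_left, real_inner_smul_left]
      linarith [hF.two_mul_inner_center_le (hF.swap₁₂ h') h]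
  · exact ⟨0, inner_zero_left _, fun b c hb => absurd ⟨b, c, hb⟩ h⟩

/-- The dual edge of a wall has nonnegative signed length. -/
theorem height_add_height_nonneg (hF : DelaunayFan S C) {a b c c' : E3} (h : (a, b, c) ∈ S)
    (h' : (a, b, c') ∈ S) (hs : det3 a b c * det3 a b c' < 0) :
    0 ≤ height C a b c + height C a b c' ∧
      (height C a b c + height C a b c' = 0 → C a b c' = C a b c) := by
  have ha : inner ℝ (C a b c' - C a b c) a = 0 := by
    rw [inner_sub_left]; linarith [hF.inner_center h, hF.inner_center h']
  have hb : inner ℝ (C a b c' - C a b c) b = 0 := by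
    rw [inner_sub_left]; linarith [hF.inner_center₂ h, hF.inner_center₂ h']
  have g := gram_pos_of_det3_ne_zero (hF.det_ne h)
  have k1 := gram_mul_inner_of_orthogonal a b _ c' ha hb
  have k2 := gram_mul_inner_of_orthogonal a b _ (C a b c' - C a b c) ha hb
  have hle := hF.inner_center_le h h' hs (mul_self_nonneg _)
  have hn : 0 ≤ det3 a b (C a b c' - C a b c) * det3 a b c' := by
    rw [← k1, inner_sub_left]
    exact mul_nonneg g.le (by linarith)
  have e : height C a b c + height C a b c'
      = Real.sign (det3 a b c') * det3 a b (C a b c' - C a b c) := by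
    have h1 := sign_eq_neg_of_mul_neg hs
    have h2 : det3 a b (C a b c' - C a b c) = det3 a b (C a b c') - det3 a b (C a b c) := by
      simp only [det3, PiLp.sub_apply]; ring
    rw [height, height, h1, h2]
    ring
  rw [e]
  rcases lt_or_gt_of_ne (hF.det_ne h') with hd | hd
  · rw [Real.sign_of_neg hd]
    refine ⟨?_, fun h0 => ?_⟩
    · have := nonpos_of_mul_nonneg_left hn hd
      linarith
    · have h0 : det3 a b (C a b c' - C a b c) = 0 := by linarith
      rw [h0, zero_mul, mul_eq_zero, inner_self_eq_zero] at k2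
      exact sub_eq_zero.1 (k2.resolve_left g.ne')
  · rw [Real.sign_of_pos hd]
    refine ⟨?_, fun h0 => ?_⟩
    · have := nonneg_of_mul_nonneg_left hn hd
      linarith
    · have h0 : det3 a b (C a b c' - C a b c) = 0 := by linarith
      rw [h0, zero_mul, mul_eq_zero, inner_self_eq_zero] at k2
      exact sub_eq_zero.1 (k2.resolve_left g.ne')

/-- The centers are not all equal across walls: otherwise there is a single center `z`, and the
cone that contains `-z` forces `⟪z, -z⟫ ≥ 0`, so `z = 0`, which is not equidistant from the
vertices. -/
theorem exists_center_ne (hF : DelaunayFan S C) : ∃ a b c c', (a, b, c) ∈ S ∧ (a, b, c') ∈ S ∧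
    det3 a b c * det3 a b c' < 0 ∧ C a b c' ≠ C a b c := by
  by_contra! hall
  obtain ⟨u, v, w, h', -⟩ := hF.cover 0
  obtain ⟨a, b, c, h, hP, α, β, γ, hα, hβ, hγ, hm⟩ := hF.exists_cone_of_crossing
    (fun p => p = C u v w) (-C u v w)
    (fun a b c c' h1 h2 hs _ hp => (hall a b c c' h1 h2 hs).trans hp) h' rfl
  have e1 := hF.inner_center h
  have e2 := hF.inner_center₂ h
  have e3 : 2 * inner ℝ (C a b c) c = inner ℝ c c := by
    rw [← hF.center_swap₂₃]; exact hF.inner_center₂ (hF.swap₂₃ h)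
  rw [hP] at e1 e2 e3
  have e4 : 2 * inner ℝ (C u v w) (-C u v w)
      = α * inner ℝ a a + β * inner ℝ b b + γ * inner ℝ c c := by
    rw [hm, inner_add_right, inner_add_right, real_inner_smul_right, real_inner_smul_right,
      real_inner_smul_right, ← e1, ← e2, ← e3]
    ring
  have e5 : 0 ≤ 2 * inner ℝ (C u v w) (-C u v w) := by
    rw [e4]
    have := real_inner_self_nonneg (x := a)
    have := real_inner_self_nonneg (x := b)
    have := real_inner_self_nonneg (x := c)
    positivity
  rw [inner_neg_right] at e5
  have e6 : C u v w = 0 := by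
    rw [← inner_self_eq_zero (𝕜 := ℝ)]
    exact le_antisymm (by linarith) real_inner_self_nonneg
  rw [e6, inner_zero_left] at e1
  have := inner_self_pos_of_det3_ne_zero (hF.det_ne h)
  linarith

theorem sum_mul_height {m : E3 → E3 → E3 → E3}
    (hm : ∀ a b c, (a, b, c) ∈ S → (a, b, m a b c) ∈ S ∧ det3 a b c * det3 a b (m a b c) < 0 ∧
      m a b (m a b c) = c) (f : E3 → E3 → ℝ) :
    2 * ∑ p ∈ S, f p.1 p.2.1 * height C p.1 p.2.1 p.2.2 = ∑ p ∈ S, f p.1 p.2.1 *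
      (height C p.1 p.2.1 p.2.2 + height C p.1 p.2.1 (m p.1 p.2.1 p.2.2)) := by
  have := sum_mirror hm (fun a b c => f a b * height C a b c)
  simp only [mul_add, Finset.sum_add_distrib]
  linarith

/-- The signed dual volume of a Delaunay fan, up to a constant factor, is positive. It is the sum
over the edges `a` of `‖a‖` times the area of the dual polygon, and these areas are nonnegative.
If they all vanished, the weights `‖a‖ ^ 2` could be replaced by `‖a‖`; by the closing condition
and the symmetry in `a` and `b` the sum of the dual edge lengths with the positive weights
`(‖a‖ + ‖b‖) * (‖a‖ * ‖b‖ - ⟪a, b⟫) / gram a b` would vanish, and the center would be the same in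
all cones. -/
theorem dual_sum_pos (hF : DelaunayFan S C) :
    0 < ∑ p ∈ S, inner ℝ p.1 p.1 * (inner ℝ p.2.1 p.2.1 - inner ℝ p.1 p.2.1) / gram p.1 p.2.1
      * height C p.1 p.2.1 p.2.2 := by
  obtain ⟨m, hm⟩ := hF.exists_mirror_map
  choose o ho hob using hF.exists_polygon_point
  set L : E3 × E3 × E3 → ℝ := fun p =>
    height C p.1 p.2.1 p.2.2 + height C p.1 p.2.1 (m p.1 p.2.1 p.2.2) with hL
  have hL0 : ∀ p ∈ S, 0 ≤ L p := fun p hp =>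
    (hF.height_add_height_nonneg hp (hm _ _ _ hp).1 (hm _ _ _ hp).2.1).1
  set r : E3 → E3 → ℝ := fun a b =>
    (inner ℝ b b - inner ℝ a b - 2 * inner ℝ (o a) b) / gram a b with hr
  have hr0 : ∀ p ∈ S, 0 ≤ r p.1 p.2.1 := by
    intro p hp
    have := hob p.1 p.2.1 p.2.2 hp
    exact div_nonneg (by linarith) (gram_pos_of_det3_ne_zero (hF.det_ne hp)).le
  -- moving the base point of each dual polygon from the midpoint of its edge to `o`
  have balance : ∀ w : E3 → ℝ,
      2 * ∑ p ∈ S, w p.1 * (inner ℝ p.2.1 p.2.1 - inner ℝ p.1 p.2.1) / gram p.1 p.2.1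
        * height C p.1 p.2.1 p.2.2 = ∑ p ∈ S, w p.1 * r p.1 p.2.1 * L p := by
    intro w
    rw [← sum_mul_height hm (fun a b => w a * r a b)]
    have h0 := hF.sum_inner_mul_height_eq_zero w o ho
    have : ∑ p ∈ S, w p.1 * (inner ℝ p.2.1 p.2.1 - inner ℝ p.1 p.2.1) / gram p.1 p.2.1
        * height C p.1 p.2.1 p.2.2 = ∑ p ∈ S, w p.1 * r p.1 p.2.1 * height C p.1 p.2.1 p.2.2
        + 2 * ∑ p ∈ S, w p.1 * (inner ℝ (o p.1) p.2.1 / gram p.1 p.2.1)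
          * height C p.1 p.2.1 p.2.2 := by
      rw [Finset.mul_sum, ← Finset.sum_add_distrib]
      refine Finset.sum_congr rfl fun p _ => ?_
      simp only [hr]
      ring
    rw [this, h0]
    ring
  by_contra hneg
  have b1 := balance (fun a => inner ℝ a a)
  have hterm : ∀ p ∈ S, 0 ≤ inner ℝ p.1 p.1 * r p.1 p.2.1 * L p := fun p hp =>
    mul_nonneg (mul_nonneg real_inner_self_nonneg (hr0 p hp)) (hL0 p hp)
  have hz : ∑ p ∈ S, inner ℝ p.1 p.1 * r p.1 p.2.1 * L p = 0 :=
    le_antisymm (by linarith) (Finset.sum_nonneg hterm)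
  rw [Finset.sum_eq_zero_iff_of_nonneg hterm] at hz
  have b2 := balance (fun a => ‖a‖)
  have hz2 : ∑ p ∈ S, ‖p.1‖ * r p.1 p.2.1 * L p = 0 := by
    refine Finset.sum_eq_zero fun p hp => ?_
    have h1 := hz p hp
    rw [mul_assoc, mul_eq_zero] at h1
    rw [mul_assoc, h1.resolve_left (inner_self_pos_of_det3_ne_zero (hF.det_ne hp)).ne', mul_zero]
  rw [hz2] at b2
  have b3 := hF.sum_swap₁₂ (fun a b c => ‖a‖ * (inner ℝ b b - inner ℝ a b) / gram a b
    * height C a b c)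
  have hz3 : ∑ p ∈ S, (‖p.1‖ + ‖p.2.1‖) * (‖p.1‖ * ‖p.2.1‖ - inner ℝ p.1 p.2.1)
      / gram p.1 p.2.1 * L p = 0 := by
    rw [hL, ← sum_mul_height hm
      (fun a b => (‖a‖ + ‖b‖) * (‖a‖ * ‖b‖ - inner ℝ a b) / gram a b)]
    have : ∑ p ∈ S, (‖p.1‖ + ‖p.2.1‖) * (‖p.1‖ * ‖p.2.1‖ - inner ℝ p.1 p.2.1)
        / gram p.1 p.2.1 * height C p.1 p.2.1 p.2.2
        = ∑ p ∈ S, ‖p.1‖ * (inner ℝ p.2.1 p.2.1 - inner ℝ p.1 p.2.1) / gram p.1 p.2.1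
          * height C p.1 p.2.1 p.2.2
        + ∑ p ∈ S, ‖p.2.1‖ * (inner ℝ p.1 p.1 - inner ℝ p.2.1 p.1) / gram p.2.1 p.1
          * height C p.2.1 p.1 p.2.2 := by
      rw [← Finset.sum_add_distrib]
      refine Finset.sum_congr rfl fun p _ => ?_
      rw [hF.height_swap₁₂ p.1, gram_comm p.2.1, real_inner_comm p.1 p.2.1,
        real_inner_self_eq_norm_sq, real_inner_self_eq_norm_sq]
      ring
    rw [this, b3]
    linarith
  have hpos : ∀ p ∈ S, 0 < (‖p.1‖ + ‖p.2.1‖) * (‖p.1‖ * ‖p.2.1‖ - inner ℝ p.1 p.2.1)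
      / gram p.1 p.2.1 := by
    intro p hp
    have g := gram_pos_of_det3_ne_zero (hF.det_ne hp)
    have n1 : 0 < ‖p.1‖ := by
      have := inner_self_pos_of_det3_ne_zero (hF.det_ne hp)
      rw [norm_pos_iff]
      exact real_inner_self_pos.1 this
    have g2 : gram p.1 p.2.1
        = (‖p.1‖ * ‖p.2.1‖ + inner ℝ p.1 p.2.1) * (‖p.1‖ * ‖p.2.1‖ - inner ℝ p.1 p.2.1) := by
      rw [gram, real_inner_self_eq_norm_sq, real_inner_self_eq_norm_sq]; ring
    have c1 := real_inner_le_norm p.1 p.2.1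
    have c2 : inner ℝ p.1 p.2.1 ≠ ‖p.1‖ * ‖p.2.1‖ := by
      intro e
      rw [e] at g2
      simp [g2] at g
    have c3 : 0 < ‖p.1‖ * ‖p.2.1‖ - inner ℝ p.1 p.2.1 := sub_pos.2 (lt_of_le_of_ne c1 c2)
    positivity
  rw [Finset.sum_eq_zero_iff_of_nonneg
    (fun p hp => mul_nonneg (hpos p hp).le (hL0 p hp))] at hz3
  obtain ⟨a, b, c, c', h, h', hs, hne⟩ := hF.exists_center_ne
  have e1 : L (a, b, c) = 0 :=
    (mul_eq_zero.1 (hz3 _ h)).resolve_left (hpos _ h).ne'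
  have e2 : m a b c = c' := by
    refine hF.eq_of_same_side (hm a b c h).1 h' ?_
    have h5 := mul_pos_of_neg_of_neg hs (hm a b c h).2.1
    have h6 := sq_pos_of_ne_zero (hF.det_ne h)
    by_contra hn
    nlinarith
  simp only [hL, e2] at e1
  exact hne ((hF.height_add_height_nonneg h h' hs).2 e1)

end DelaunayFan

/-! ### The star of an internal vertex -/

open scoped Classical in
/-- The vertex set of the tetrahedron with vertex `v` and edge vectors `a`, `b`, `c` at `v`. -/
noncomputable def tet (v a b c : E3) : Finset E3 := {v, v + a, v + b, v + c}

theorem mem_tet {v a b c x : E3} :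
    x ∈ tet v a b c ↔ x = v ∨ x = v + a ∨ x = v + b ∨ x = v + c := by
  simp [tet]

theorem tet_swap₁₂ (v a b c : E3) : tet v b a c = tet v a b c := by
  ext x; simp only [mem_tet]; tauto

theorem tet_swap₂₃ (v a b c : E3) : tet v a c b = tet v a b c := by
  ext x; simp only [mem_tet]; tauto

theorem injective_of_card_tet {v a b c : E3} (h : (tet v a b c).card = 4) :
    Function.Injective ![v, v + a, v + b, v + c] := by
  classical
  have e : tet v a b c = Finset.univ.image ![v, v + a, v + b, v + c] := by
    ext x
    simp [mem_tet, Fin.exists_fin_succ, eq_comm]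
  rw [e] at h
  have := Finset.injOn_of_card_image_eq (s := Finset.univ) (f := ![v, v + a, v + b, v + c])
    (by rw [h]; rfl)
  exact fun x y hxy => this (Finset.mem_coe.2 (Finset.mem_univ _))
    (Finset.mem_coe.2 (Finset.mem_univ _)) hxy

theorem det3_ne_zero_of_linearIndependent {a b c : E3} (h : LinearIndependent ℝ ![a, b, c]) :
    det3 a b c ≠ 0 := by
  have h2 := h.map' (WithLp.linearEquiv 2 ℝ (Fin 3 → ℝ)).toLinearMap (LinearEquiv.ker _)
  have h3 := (Matrix.linearIndependent_rows_iff_isUnit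
    (A := Matrix.of ((WithLp.linearEquiv 2 ℝ (Fin 3 → ℝ)) ∘ ![a, b, c]))).1 h2
  rw [Matrix.isUnit_iff_isUnit_det, isUnit_iff_ne_zero, Matrix.det_fin_three] at h3
  intro h0
  apply h3
  rw [← h0]
  simp [det3]
  ring

theorem det3_ne_zero_of_affineIndependent {p : Fin 4 → E3} (h : AffineIndependent ℝ p) :
    det3 (p 1 - p 0) (p 2 - p 0) (p 3 - p 0) ≠ 0 := by
  rw [affineIndependent_iff_linearIndependent_vsub ℝ _ (0 : Fin 4)] at h
  have h2 := h.comp (fun i : Fin 3 => (⟨i.succ, Fin.succ_ne_zero i⟩ : {x : Fin 4 // x ≠ 0}))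
    (fun i j hij => Fin.succ_injective _ (congrArg Subtype.val hij))
  refine det3_ne_zero_of_linearIndependent ?_
  have e : ![p 1 - p 0, p 2 - p 0, p 3 - p 0]
      = (fun i : {x : Fin 4 // x ≠ 0} => p i -ᵥ p 0) ∘
        fun i : Fin 3 => (⟨i.succ, Fin.succ_ne_zero i⟩ : {x : Fin 4 // x ≠ 0}) := by
    funext i
    fin_cases i <;> rfl
  rw [e]
  exact h2

theorem affineIndependent_of_injective {s : Finset E3} {p : Fin 4 → E3}
    (hi : AffineIndependent ℝ ((↑) : s → E3)) (hinj : Function.Injective p)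
    (hmem : ∀ i, p i ∈ s) : AffineIndependent ℝ p := by
  have hj : Function.Injective (fun i : Fin 4 => (⟨p i, hmem i⟩ : s)) :=
    fun i j hij => hinj (Subtype.ext_iff.1 hij)
  have := hi.comp_embedding ⟨_, hj⟩
  exact this

theorem det3_ne_zero_of_tet {v a b c : E3} (hc : (tet v a b c).card = 4)
    (hi : AffineIndependent ℝ ((↑) : tet v a b c → E3)) : det3 a b c ≠ 0 := by
  have hinj := injective_of_card_tet hc
  have hmem : ∀ i, ![v, v + a, v + b, v + c] i ∈ tet v a b c := by
    intro i; fin_cases i <;> simp [mem_tet]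
  have e : det3 a b c = det3 (![v, v + a, v + b, v + c] 1 - ![v, v + a, v + b, v + c] 0)
      (![v, v + a, v + b, v + c] 2 - ![v, v + a, v + b, v + c] 0)
      (![v, v + a, v + b, v + c] 3 - ![v, v + a, v + b, v + c] 0) := by
    simp
  rw [e]
  exact det3_ne_zero_of_affineIndependent (affineIndependent_of_injective hi hinj hmem)

theorem smul_mem_convexHull_tet {v a b c : E3} {α β γ ε : ℝ} (hα : 0 ≤ α) (hβ : 0 ≤ β)
    (hγ : 0 ≤ γ) (hε : 0 ≤ ε) (h : ε * (α + β + γ) ≤ 1) :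
    v + ε • (α • a + β • b + γ • c) ∈ convexHull ℝ (tet v a b c : Set E3) := by
  have hm : ∀ x ∈ tet v a b c, x ∈ convexHull ℝ (tet v a b c : Set E3) :=
    fun x hx => subset_convexHull ℝ _ hx
  have key := (convex_convexHull ℝ (tet v a b c : Set E3)).sum_mem (t := Finset.univ)
    (w := ![1 - ε * (α + β + γ), ε * α, ε * β, ε * γ]) (z := ![v, v + a, v + b, v + c])
    (by
      intro i _
      fin_cases i
      · simpa using h
      all_goals simp; positivity)
    (by simp [Fin.sum_univ_four]; ring)
    (by intro i _; fin_cases i <;> exact hm _ (by simp [mem_tet]))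
  convert key using 1
  simp only [Fin.sum_univ_four, Matrix.cons_val]
  module

theorem mem_cone3_of_mem_convexHull_tet {v a b c x : E3}
    (h : x ∈ convexHull ℝ (tet v a b c : Set E3)) : x - v ∈ cone3 a b c := by
  have hc : Convex ℝ {y : E3 | y - v ∈ cone3 a b c} := by
    rintro x ⟨α, β, γ, hα, hβ, hγ, hx⟩ y ⟨α', β', γ', hα', hβ', hγ', hy⟩ s t hs ht hst
    refine ⟨s * α + t * α', s * β + t * β', s * γ + t * γ', by positivity, by positivity,
      by positivity, ?_⟩
    have : s • x + t • y - v = s • (x - v) + t • (y - v) := by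
      have : v = (s + t) • v := by rw [hst, one_smul]
      nth_rw 1 [this]
      module
    rw [this, hx, hy]
    module
  refine convexHull_min ?_ hc h
  intro y hy
  rcases mem_tet.1 hy with rfl | rfl | rfl | rfl
  · exact ⟨0, 0, 0, le_rfl, le_rfl, le_rfl, by simp⟩
  · exact ⟨1, 0, 0, zero_le_one, le_rfl, le_rfl, by simp⟩
  · exact ⟨0, 1, 0, le_rfl, zero_le_one, le_rfl, by simp⟩
  · exact ⟨0, 0, 1, le_rfl, le_rfl, zero_le_one, by simp⟩

/-- The circumcenter of the tetrahedron `v, v + a, v + b, v + c`, relative to `v`. -/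
noncomputable def relCenter (v a b c : E3) : E3 := (finsetCircumsphere (tet v a b c)).center - v

/-- A point equidistant from `v` and `v + a` lies on the bisector plane. -/
theorem two_mul_inner_of_dist_eq {v a z : E3} (h : dist (v + a) z = dist v z) :
    2 * inner ℝ (z - v) a = inner ℝ a a := by
  rw [dist_eq_norm, dist_eq_norm] at h
  have h1 : inner ℝ (v + a - z) (v + a - z) = inner ℝ (v - z) (v - z) := by
    rw [real_inner_self_eq_norm_sq, real_inner_self_eq_norm_sq, h]
  have e : v + a - z = a - (z - v) := by abel
  have e2 : v - z = -(z - v) := by abel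
  rw [e, e2, inner_neg_neg] at h1
  generalize z - v = w at h1 ⊢
  rw [inner_sub_left, inner_sub_right, inner_sub_right, real_inner_comm w a] at h1
  linarith

section Star

variable (K : Geometry.SimplicialComplex ℝ E3) (v : E3)

/-- The ordered triples of edge vectors at `v` of the tetrahedra of `K` with vertex `v`. -/
def starTriples : Set (E3 × E3 × E3) :=
  {p | tet v p.1 p.2.1 p.2.2 ∈ K.faces ∧ (tet v p.1 p.2.1 p.2.2).card = 4}

variable {K v}

theorem starTriples_finite (hK : K.faces.Finite) : (starTriples K v).Finite := by
  set A : Set E3 := (fun x => x - v) '' ⋃ s ∈ K.faces, (s : Set E3) with hA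
  have hAf : A.Finite := (hK.biUnion fun s _ => s.finite_toSet).image _
  refine (hAf.prod (hAf.prod hAf)).subset ?_
  rintro ⟨a, b, c⟩ ⟨h, -⟩
  have hm : ∀ u, v + u ∈ tet v a b c → u ∈ A := fun u hu =>
    ⟨v + u, Set.mem_biUnion h hu, by simp⟩
  exact ⟨hm a (by simp [mem_tet]), hm b (by simp [mem_tet]), hm c (by simp [mem_tet])⟩

theorem starTriples_det3_ne_zero {a b c : E3} (h : (a, b, c) ∈ starTriples K v) :
    det3 a b c ≠ 0 := det3_ne_zero_of_tet h.2 (K.indep h.1)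

theorem starTriples_dist {a b c x : E3} (h : (a, b, c) ∈ starTriples K v)
    (hx : x ∈ tet v a b c) : dist x (finsetCircumsphere (tet v a b c)).center
      = (finsetCircumsphere (tet v a b c)).radius :=
  EuclideanGeometry.mem_sphere.1
    ((finsetCircumsphere_spec ⟨v, by simp [mem_tet]⟩ (K.indep h.1)).2 x hx)

/-- The cones of the tetrahedra at an internal vertex cover the space. -/
theorem exists_cone3_of_isInternalVertex (hK : IsTetrahedralMesh K) (hv : IsInternalVertex K v)
    (x : E3) : ∃ a b c, (a, b, c) ∈ starTriples K v ∧ x ∈ cone3 a b c := by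
  classical
  have h1 : ∀ᶠ y in 𝓝 v, y ∈ K.space := mem_interior_iff_mem_nhds.1 hv.2
  have h2 : ∀ᶠ y in 𝓝 v, ∀ s ∈ K.faces, v ∉ convexHull ℝ (s : Set E3) →
      y ∉ convexHull ℝ (s : Set E3) := by
    rw [Filter.eventually_all_finite hK.finite]
    intro s _
    by_cases hs : v ∈ convexHull ℝ (s : Set E3)
    · exact Eventually.of_forall fun y hn => absurd hs hn
    · filter_upwards [(s.finite_toSet.isClosed_convexHull ℝ).isOpen_compl.mem_nhds hs]
        with y hy _ using hy
  have ht : Tendsto (fun ε : ℝ => v + ε • x) (𝓝[>] 0) (𝓝 v) := by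
    have : Continuous (fun ε : ℝ => v + ε • x) := by fun_prop
    have h2 := this.tendsto 0
    simp only [zero_smul, add_zero] at h2
    exact h2.mono_left nhdsWithin_le_nhds
  obtain ⟨ε, ⟨h3, h4⟩, hε⟩ := ((ht.eventually (h1.and h2)).and self_mem_nhdsWithin).exists
  have hε : 0 < ε := hε
  obtain ⟨s, hs, hxs⟩ := Geometry.SimplicialComplex.mem_space_iff.1 h3
  obtain ⟨t, ht, hst, hcard⟩ := hK.pure s hs
  have hxt := convexHull_mono (Finset.coe_subset.2 hst) hxs
  have hvt : v ∈ t := (Geometry.SimplicialComplex.vertex_mem_convexHull_iff hv.1 ht).1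
    (by_contra fun hn => h4 t ht hn hxt)
  have hc3 : (t.erase v).card = 3 := by rw [Finset.card_erase_of_mem hvt, hcard]
  obtain ⟨p, q, r, -, -, -, e⟩ := Finset.card_eq_three.1 hc3
  have et : t = tet v (p - v) (q - v) (r - v) := by
    rw [← Finset.insert_erase hvt, e]
    ext y
    simp [mem_tet]
  refine ⟨p - v, q - v, r - v, ⟨et ▸ ht, et ▸ hcard⟩, ?_⟩
  rw [et] at hxt
  obtain ⟨α, β, γ, hα, hβ, hγ, hx⟩ := mem_cone3_of_mem_convexHull_tet hxt
  rw [add_sub_cancel_left] at hx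
  refine ⟨ε⁻¹ * α, ε⁻¹ * β, ε⁻¹ * γ, by positivity, by positivity, by positivity, ?_⟩
  rw [← inv_smul_smul₀ hε.ne' x, hx]
  module

/-- If a point of one cone has a positive coordinate along `c` and lies in a second cone, then `c`
is an edge of the second cone. -/
theorem starTriples_inter {a b c a' b' c' : E3} (h : (a, b, c) ∈ starTriples K v)
    (h' : (a', b', c') ∈ starTriples K v) {α β γ : ℝ} (hα : 0 ≤ α) (hβ : 0 ≤ β) (hγ : 0 < γ)
    (hm : α • a + β • b + γ • c ∈ cone3 a' b' c') : c = a' ∨ c = b' ∨ c = c' := by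
  obtain ⟨α', β', γ', hα', hβ', hγ', e⟩ := hm
  set M := 1 + (α + β + γ) + (α' + β' + γ') with hM
  have hMp : 0 < M := by positivity
  have hx : v + M⁻¹ • (α • a + β • b + γ • c) ∈ convexHull ℝ (tet v a b c : Set E3) := by
    refine smul_mem_convexHull_tet hα hβ hγ.le (by positivity) ?_
    rw [inv_mul_le_iff₀ hMp]
    linarith
  have hx' : v + M⁻¹ • (α • a + β • b + γ • c) ∈ convexHull ℝ (tet v a' b' c' : Set E3) := by
    rw [e]
    refine smul_mem_convexHull_tet hα' hβ' hγ' (by positivity) ?_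
    rw [inv_mul_le_iff₀ hMp]
    linarith
  have hd := starTriples_det3_ne_zero h
  have hi := K.inter_subset_convexHull h.1 h'.1 ⟨hx, hx'⟩
  by_contra hn
  have hcn : v + c ∉ tet v a' b' c' := by
    simp only [mem_tet, add_eq_left, add_right_inj, not_or] at hn ⊢
    refine ⟨?_, hn⟩
    rintro rfl
    exact hd (by simp [det3])
  -- all common vertices, hence all common points, lie in the plane through `v`, `v + a`, `v + b`
  have hconv : Convex ℝ {y : E3 | det3 a b (y - v) = 0} := by
    intro x hx y hy s t _ _ hst
    have hx : det3 a b (x - v) = 0 := hx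
    have hy : det3 a b (y - v) = 0 := hy
    have hs : s = 1 - t := by linarith
    have : det3 a b (s • x + t • y - v) = s * det3 a b (x - v) + t * det3 a b (y - v) := by
      rw [hs]
      simp only [det3, PiLp.add_apply, PiLp.sub_apply, PiLp.smul_apply, smul_eq_mul]; ring
    rw [Set.mem_ofPred_eq, this, hx, hy]
    ring
  have h0 : det3 a b (v + M⁻¹ • (α • a + β • b + γ • c) - v) = 0 := by
    refine convexHull_min ?_ hconv hi
    rintro y ⟨hy1, hy2⟩
    rcases mem_tet.1 hy1 with rfl | rfl | rfl | rfl
    · simp [det3]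
    · simp [det3_self_left]
    · simp [det3_self_right]
    · exact absurd hy2 hcn
  have : det3 a b (v + M⁻¹ • (α • a + β • b + γ • c) - v) = M⁻¹ * γ * det3 a b c := by
    simp only [det3, PiLp.add_apply, PiLp.sub_apply, PiLp.smul_apply, smul_eq_mul]; ring
  rw [this] at h0
  have := mul_ne_zero (mul_pos (inv_pos.2 hMp) hγ).ne' hd
  exact this h0

theorem delaunayFan_of_isInternalVertex (hK : IsTetrahedralMesh K) (hD : IsDelaunayMesh K)
    (hv : IsInternalVertex K v) :
    DelaunayFan (starTriples_finite (v := v) hK.finite).toFinset (relCenter v) where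
  swap₁₂ {a b c} h := by
    rw [Set.Finite.mem_toFinset] at h ⊢
    simpa only [starTriples, Set.mem_ofPred_eq, tet_swap₁₂] using h
  swap₂₃ {a b c} h := by
    rw [Set.Finite.mem_toFinset] at h ⊢
    simpa only [starTriples, Set.mem_ofPred_eq, tet_swap₂₃] using h
  det_ne h := starTriples_det3_ne_zero ((Set.Finite.mem_toFinset _).1 h)
  cover x := by
    simpa only [Set.Finite.mem_toFinset] using exists_cone3_of_isInternalVertex hK hv x
  inter h h' α β γ hα hβ hγ hm := starTriples_inter ((Set.Finite.mem_toFinset _).1 h)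
    ((Set.Finite.mem_toFinset _).1 h') hα hβ hγ hm
  center_swap₁₂ a b c := by rw [relCenter, relCenter, tet_swap₁₂]
  center_swap₂₃ a b c := by rw [relCenter, relCenter, tet_swap₂₃]
  inner_center {a b c} h := by
    rw [Set.Finite.mem_toFinset] at h
    exact two_mul_inner_of_dist_eq ((starTriples_dist h (by simp [mem_tet])).trans
      (starTriples_dist h (by simp [mem_tet])).symm)
  delaunay {a b c c'} h h' hne := by
    classical
    rw [Set.Finite.mem_toFinset] at h h'
    have hd' := starTriples_det3_ne_zero h'
    have hnot : v + c' ∉ tet v a b c := by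
      simp only [mem_tet, add_eq_left, add_right_inj, not_or]
      refine ⟨?_, ?_, ?_, hne.symm⟩ <;> rintro rfl
      · exact hd' (by simp [det3])
      · exact hd' (det3_self_left _ _)
      · exact hd' (det3_self_right _ _)
    have hd := starTriples_det3_ne_zero h
    have hinter : tet v a b c ∩ tet v a b c' = (tet v a b c').erase (v + c') := by
      ext x
      simp only [Finset.mem_inter, Finset.mem_erase]
      constructor
      · rintro ⟨h1, h2⟩
        exact ⟨fun e => hnot (e ▸ h1), h2⟩
      · rintro ⟨h1, h2⟩
        refine ⟨?_, h2⟩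
        rw [mem_tet] at h2 ⊢
        tauto
    have hcard : (tet v a b c ∩ tet v a b c').card = 3 := by
      rw [hinter, Finset.card_erase_of_mem (by simp [mem_tet]), h'.2]
    have hb := hD _ h.1 _ h'.1 h.2 h'.2 (by convert hcard) (v + c') (by simp [mem_tet]) hnot
    rw [Metric.mem_ball, not_lt, ← starTriples_dist h (x := v) (by simp [mem_tet]),
      dist_eq_norm, dist_eq_norm] at hb
    have h1 := pow_le_pow_left₀ (norm_nonneg _) hb 2
    have e : v + c' - (finsetCircumsphere (tet v a b c)).center = c' - relCenter v a b c := by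
      rw [relCenter]; abel
    have e2 : v - (finsetCircumsphere (tet v a b c)).center = -relCenter v a b c := by
      rw [relCenter]; abel
    rw [e, e2, norm_neg, ← real_inner_self_eq_norm_sq, ← real_inner_self_eq_norm_sq,
      inner_sub_left, inner_sub_right, inner_sub_right, real_inner_comm (relCenter v a b c) c'] at h1
    linarith

end Star

/-! ### Elementary dual simplices -/

/-- Tetrahedra are affine images of one another, so their volumes are proportional to their
determinants. The value `1 / 6` of the constant is not needed. -/
theorem exists_volume_convexHull : ∃ κ : ℝ, 0 < κ ∧ ∀ p : Fin 4 → E3,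
    (MeasureTheory.volume (convexHull ℝ (Set.range p))).toReal
      = κ * |det3 (p 1 - p 0) (p 2 - p 0) (p 3 - p 0)| := by
  set b := (EuclideanSpace.basisFun (Fin 3) ℝ).toBasis with hb
  have hbe : ∀ i, b i = EuclideanSpace.single i (1 : ℝ) := by
    intro i; simp [hb]
  set q : Fin 4 → E3 := ![0, b 0, b 1, b 2] with hq
  have hvol : ∀ p : Fin 4 → E3, MeasureTheory.volume (convexHull ℝ (Set.range p))
      = ENNReal.ofReal |det3 (p 1 - p 0) (p 2 - p 0) (p 3 - p 0)|
        * MeasureTheory.volume (convexHull ℝ (Set.range q)) := by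
    intro p
    set M : Matrix (Fin 3) (Fin 3) ℝ :=
      Matrix.of fun i j => (p j.succ - p 0) i with hM
    set f : E3 →ₗ[ℝ] E3 := Matrix.toLin b b M with hf
    have hfb : ∀ j, f (b j) = p j.succ - p 0 := by
      intro j
      rw [hf, Matrix.toLin_self]
      ext i
      simp only [hbe, hM, Matrix.of_apply, Fin.sum_univ_three]
      fin_cases i <;> simp
    have hdet : LinearMap.det f = det3 (p 1 - p 0) (p 2 - p 0) (p 3 - p 0) := by
      rw [hf, LinearMap.det_toLin, Matrix.det_fin_three]
      simp only [hM, Matrix.of_apply, det3, Fin.succ_zero_eq_one, Fin.succ_one_eq_two,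
        show (2 : Fin 3).succ = (3 : Fin 4) from rfl]
      ring
    set g : E3 →ᵃ[ℝ] E3 := f.toAffineMap + AffineMap.const ℝ E3 (p 0) with hg
    have hgx : ∀ x, g x = f x + p 0 := fun x => rfl
    have hgq : g '' Set.range q = Set.range p := by
      rw [← Set.range_comp]
      congr 1
      funext i
      simp only [Function.comp, hgx]
      fin_cases i
      · simp [hq]
      · simp [hq, hfb]
      · simp [hq, hfb]
      · simp [hq, hfb]
    have himg : convexHull ℝ (Set.range p)
        = (fun x => x + p 0) '' (f '' convexHull ℝ (Set.range q)) := by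
      rw [← hgq, ← AffineMap.image_convexHull, Set.image_image]
      rfl
    rw [himg, Set.image_add_right, MeasureTheory.measure_preimage_add_right,
      MeasureTheory.Measure.addHaar_image_linearMap, hdet]
  refine ⟨(MeasureTheory.volume (convexHull ℝ (Set.range q))).toReal, ?_, fun p => ?_⟩
  · have hfin : MeasureTheory.volume (convexHull ℝ (Set.range q)) ≠ ⊤ :=
      ((Set.finite_range q).isCompact_convexHull ℝ).measure_lt_top.ne
    refine ENNReal.toReal_pos (fun h0 => ?_) hfin
    have hrange : Set.range q = insert 0 (Set.range b) := by
      ext x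
      simp [hq, Fin.exists_fin_succ, eq_comm]
      tauto
    have hspan : affineSpan ℝ (Set.range q) = ⊤ := by
      apply SetLike.coe_injective
      rw [hrange, affineSpan_insert_zero, b.span_eq]
      rfl
    have hne := interior_convexHull_nonempty_iff_affineSpan_eq_top.2 hspan
    exact (isOpen_interior.measure_pos MeasureTheory.volume hne).ne'
      (MeasureTheory.measure_mono_null interior_subset h0)
  · rw [hvol, ENNReal.toReal_mul, ENNReal.toReal_ofReal (abs_nonneg _), mul_comm]

theorem stepSign_eq {s t : Finset E3} {w p₁ p₂ : E3} {τ : ℝ} (hw : w ∈ t)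
    (hws : w ∉ affineSpan ℝ (s : Set E3)) (hu : ∀ x ∈ t, x ∉ s → x = w)
    (hp₁ : p₁ ∈ affineSpan ℝ (s : Set E3)) (hp₂ : p₂ ∈ affineSpan ℝ (s : Set E3))
    (hc : (finsetCircumsphere t).center = τ • (w - p₁) + p₂) :
    stepSign s t = if 0 < τ then 1 else -1 := by
  have hiff : (∃ x ∈ t, x ∉ s ∧ (affineSpan ℝ (s : Set E3)).SSameSide x
      (finsetCircumsphere t).center) ↔ 0 < τ := by
    refine ⟨?_, fun h => ⟨w, hw, fun h' => hws (subset_affineSpan ℝ _ h'), ?_⟩⟩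
    · rintro ⟨x, hx, hxs, hside⟩
      obtain rfl := hu x hx hxs
      by_contra hn
      rcases (not_lt.1 hn).eq_or_lt with rfl | hneg
      · refine hside.right_notMem ?_
        rw [hc]
        simpa using hp₂
      · refine (AffineSubspace.sOppSide_smul_vsub_vadd_right hws hp₁ hp₂ hneg).not_sSameSide ?_
        rw [hc] at hside
        exact hside
    · rw [hc]
      exact AffineSubspace.sSameSide_smul_vsub_vadd_right hws hp₁ hp₂ h
  by_cases h : 0 < τ
  · rw [stepSign, if_pos (hiff.2 h), if_pos h]
  · rw [stepSign, if_neg (mt hiff.1 h), if_neg h]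

theorem mem_affineSpan_triple {v a b x : E3} : x ∈ affineSpan ℝ {v, v + a, v + b} ↔
    ∃ α β : ℝ, x = v + α • a + β • b := by
  constructor
  · intro h
    have hle : affineSpan ℝ {v, v + a, v + b}
        ≤ AffineSubspace.mk' v (Submodule.span ℝ {a, b}) := by
      rw [affineSpan_le]
      have ha : a ∈ Submodule.span ℝ {a, b} := Submodule.subset_span (by simp)
      have hb : b ∈ Submodule.span ℝ {a, b} := Submodule.subset_span (by simp)
      rintro y (rfl | rfl | rfl)
      · exact AffineSubspace.self_mem_mk' _ _
      · simpa [AffineSubspace.mem_mk'] using ha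
      · simpa [AffineSubspace.mem_mk'] using hb
    have h1 := hle h
    rw [AffineSubspace.mem_mk', Submodule.mem_span_pair] at h1
    obtain ⟨α, β, e⟩ := h1
    refine ⟨α, β, ?_⟩
    rw [vsub_eq_sub] at e
    rw [add_assoc, e]
    abel
  · rintro ⟨α, β, rfl⟩
    have hv : v ∈ affineSpan ℝ {v, v + a, v + b} := subset_affineSpan ℝ _ (by simp)
    have ha : v + a ∈ affineSpan ℝ {v, v + a, v + b} := subset_affineSpan ℝ _ (by simp)
    have hb : v + b ∈ affineSpan ℝ {v, v + a, v + b} := subset_affineSpan ℝ _ (by simp)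
    have h1 := AffineSubspace.smul_vsub_vadd_mem _ α ha hv hv
    have h2 := AffineSubspace.smul_vsub_vadd_mem _ β hb hv h1
    convert h2 using 1
    simp only [vsub_eq_sub, vadd_eq_add]
    module

theorem mem_affineSpan_add_pair {v a x : E3} : x ∈ affineSpan ℝ {v, v + a} ↔
    ∃ α : ℝ, x = v + α • a := by
  have h : ({v, v + a} : Set E3) = {v, v + a, v + 0} := by
    ext y; simp; tauto
  rw [h, mem_affineSpan_triple]
  simp

section Flags

variable {K : Geometry.SimplicialComplex ℝ E3} {v : E3}

open scoped Classical in
/-- The flag `{v} ≺ {v, v + a} ≺ {v, v + a, v + b} ≺ {v, v + a, v + b, v + c}`. -/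
noncomputable def flagOf (v : E3) (p : E3 × E3 × E3) : Fin 4 → Finset E3 :=
  ![{v}, {v, v + p.1}, {v, v + p.1, v + p.2.1}, tet v p.1 p.2.1 p.2.2]

theorem bijOn_flagOf : Set.BijOn (flagOf v) (starTriples K v) (flagsAt K v) := by
  classical
  refine ⟨?_, ?_, ?_⟩
  · rintro ⟨a, b, c⟩ ⟨h, hc⟩
    have hinj := injective_of_card_tet hc
    have h01 : v ≠ v + a := fun e => by simpa using hinj (a₁ := 0) (a₂ := 1) e
    have h02 : v ≠ v + b := fun e => by simpa using hinj (a₁ := 0) (a₂ := 2) e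
    have h12 : v + a ≠ v + b := fun e => by simpa using hinj (a₁ := 1) (a₂ := 2) e
    refine ⟨rfl, ?_, ?_⟩
    · refine Fin.monotone_iff_le_succ.2 fun i => ?_
      fin_cases i <;> simp [flagOf, tet, Finset.insert_subset_iff]
    · intro i
      fin_cases i
      · exact ⟨K.down_closed h (by simp [flagOf, tet]) (by simp [flagOf]), by simp [flagOf]⟩
      · exact ⟨K.down_closed h (by simp [flagOf, tet, Finset.insert_subset_iff])
          (by simp [flagOf]), by simpa [flagOf] using Finset.card_pair h01⟩
      · refine ⟨K.down_closed h (by simp [flagOf, tet, Finset.insert_subset_iff])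
          (by simp [flagOf]), ?_⟩
        exact Finset.card_eq_three.2 ⟨_, _, _, h01, h02, h12, rfl⟩
      · exact ⟨h, hc⟩
  · rintro ⟨a, b, c⟩ ⟨h, hc⟩ ⟨a', b', c'⟩ ⟨h', hc'⟩ e
    have hinj := injective_of_card_tet hc
    have h01 : v ≠ v + a := fun e => by simpa using hinj (a₁ := 0) (a₂ := 1) e
    have h02 : v ≠ v + b := fun e => by simpa using hinj (a₁ := 0) (a₂ := 2) e
    have h12 : v + a ≠ v + b := fun e => by simpa using hinj (a₁ := 1) (a₂ := 2) e
    have h03 : v ≠ v + c := fun e => by simpa using hinj (a₁ := 0) (a₂ := 3) e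
    have h13 : v + a ≠ v + c := fun e => by simpa using hinj (a₁ := 1) (a₂ := 3) e
    have h23 : v + b ≠ v + c := fun e => by simpa using hinj (a₁ := 2) (a₂ := 3) e
    have e1 : ({v, v + a} : Finset E3) = {v, v + a'} := congrFun e 1
    have e2 : ({v, v + a, v + b} : Finset E3) = {v, v + a', v + b'} := congrFun e 2
    have e3 : tet v a b c = tet v a' b' c' := congrFun e 3
    have m1 : v + a ∈ ({v, v + a'} : Finset E3) := by rw [← e1]; simp
    have m2 : v + b ∈ ({v, v + a', v + b'} : Finset E3) := by rw [← e2]; simp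
    have m3 : v + c ∈ tet v a' b' c' := by rw [← e3]; simp [mem_tet]
    have ea : a = a' := by
      simp only [Finset.mem_insert, Finset.mem_singleton] at m1
      exact add_left_cancel (m1.resolve_left h01.symm)
    subst ea
    have eb : b = b' := by
      simp only [Finset.mem_insert, Finset.mem_singleton] at m2
      exact add_left_cancel ((m2.resolve_left h02.symm).resolve_left h12.symm)
    subst eb
    have ec : c = c' := by
      rw [mem_tet] at m3
      exact add_left_cancel
        (((m3.resolve_left h03.symm).resolve_left h13.symm).resolve_left h23.symm)
    rw [ec]
  · rintro F ⟨h0, hmono, hF⟩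
    have c0 := (hF 0).2
    have c1 := (hF 1).2
    have c2 := (hF 2).2
    have c3 := (hF 3).2
    obtain ⟨x, -, e1⟩ := Finset.exists_eq_insert_iff.2
      ⟨hmono (show (0 : Fin 4) ≤ 1 by decide), by rw [c0, c1]; rfl⟩
    obtain ⟨y, -, e2⟩ := Finset.exists_eq_insert_iff.2
      ⟨hmono (show (1 : Fin 4) ≤ 2 by decide), by rw [c1, c2]; rfl⟩
    obtain ⟨z, -, e3⟩ := Finset.exists_eq_insert_iff.2
      ⟨hmono (show (2 : Fin 4) ≤ 3 by decide), by rw [c2, c3]; rfl⟩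
    have f1 : F 1 = {v, v + (x - v)} := by
      rw [← e1, h0]; ext u; simp; tauto
    have f2 : F 2 = {v, v + (x - v), v + (y - v)} := by
      rw [← e2, f1]; ext u; simp; tauto
    have f3 : F 3 = tet v (x - v) (y - v) (z - v) := by
      rw [← e3, f2]; ext u; simp [mem_tet]; tauto
    refine ⟨(x - v, y - v, z - v), ⟨?_, ?_⟩, ?_⟩
    · rw [← f3]; exact (hF 3).1
    · rw [← f3]; exact c3
    · funext i
      fin_cases i
      · exact h0.symm
      · exact f1.symm
      · exact f2.symm
      · exact f3.symm

/-- The signed volume of an elementary dual simplex as an algebraic expression: the sign of each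
step turns the absolute value of the corresponding factor of the determinant into its signed
value. -/
theorem elementary_signed_volume {κ : ℝ} (hκ : ∀ p : Fin 4 → E3,
    (MeasureTheory.volume (convexHull ℝ (Set.range p))).toReal
      = κ * |det3 (p 1 - p 0) (p 2 - p 0) (p 3 - p 0)|)
    {a b c : E3} (h : (a, b, c) ∈ starTriples K v) :
    elementarySign (flagOf v (a, b, c))
        * (MeasureTheory.volume (elementaryDual (flagOf v (a, b, c)))).toReal
      = κ / 4 * (inner ℝ a a * (inner ℝ b b - inner ℝ a b) / gram a b
        * DelaunayFan.height (relCenter v) a b c) := by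
  classical
  have hd := starTriples_det3_ne_zero h
  have g := gram_pos_of_det3_ne_zero hd
  have hfl := (bijOn_flagOf (K := K) (v := v)).mapsTo h
  have hsph : ∀ i, (finsetCircumsphere (flagOf v (a, b, c) i)).center
        ∈ affineSpan ℝ (flagOf v (a, b, c) i : Set E3) ∧
      ∀ x ∈ flagOf v (a, b, c) i, x ∈ finsetCircumsphere (flagOf v (a, b, c) i) := fun i =>
    finsetCircumsphere_spec (K.nonempty_of_mem_faces (hfl.2.2 i).1) (K.indep (hfl.2.2 i).1)
  have hdist : ∀ i, ∀ x ∈ flagOf v (a, b, c) i, ∀ y ∈ flagOf v (a, b, c) i,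
      dist x (finsetCircumsphere (flagOf v (a, b, c) i)).center
        = dist y (finsetCircumsphere (flagOf v (a, b, c) i)).center := fun i x hx y hy =>
    (EuclideanGeometry.mem_sphere.1 ((hsph i).2 x hx)).trans
      (EuclideanGeometry.mem_sphere.1 ((hsph i).2 y hy)).symm
  have ia := inner_self_pos_of_det3_ne_zero hd
  -- the four centers
  have z0 : (finsetCircumsphere (flagOf v (a, b, c) 0)).center = v := by
    have := (hsph 0).1
    simpa [flagOf] using this
  obtain ⟨ρ, z1⟩ : ∃ ρ : ℝ, (finsetCircumsphere (flagOf v (a, b, c) 1)).center = v + ρ • a := by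
    have := (hsph 1).1
    simpa [flagOf, mem_affineSpan_add_pair] using this
  obtain ⟨l, μ, z2⟩ : ∃ l μ : ℝ, (finsetCircumsphere (flagOf v (a, b, c) 2)).center
      = v + l • a + μ • b := by
    have := (hsph 2).1
    simpa [flagOf, mem_affineSpan_triple] using this
  have z3 : (finsetCircumsphere (flagOf v (a, b, c) 3)).center = v + relCenter v a b c := by
    rw [relCenter, add_sub_cancel]; rfl
  have hρ : ρ = 1 / 2 := by
    have := two_mul_inner_of_dist_eq (hdist 1 (v + a) (by simp [flagOf]) v (by simp [flagOf]))
    rw [z1, add_sub_cancel_left, real_inner_smul_left] at this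
    have h2 : (2 * ρ - 1) * inner ℝ a a = 0 := by linarith
    rcases mul_eq_zero.1 h2 with h3 | h3
    · linarith
    · exact absurd h3 ia.ne'
  have hμ : μ = inner ℝ a a * (inner ℝ b b - inner ℝ a b) / (2 * gram a b) := by
    have h1 := two_mul_inner_of_dist_eq (hdist 2 (v + a) (by simp [flagOf]) v (by simp [flagOf]))
    have h2 := two_mul_inner_of_dist_eq (hdist 2 (v + b) (by simp [flagOf]) v (by simp [flagOf]))
    rw [z2, add_assoc, add_sub_cancel_left, inner_add_left, real_inner_smul_left,
      real_inner_smul_left] at h1 h2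
    rw [real_inner_comm a b] at h1
    rw [eq_div_iff (by positivity), gram]
    linear_combination inner ℝ a a * h2 - inner ℝ a b * h1
  -- the signs of the steps
  have w2 : v + b ∉ affineSpan ℝ ({v, v + a} : Set E3) := by
    rw [mem_affineSpan_add_pair]
    rintro ⟨α, e⟩
    obtain rfl := add_left_cancel e
    exact hd (by simp only [det3, PiLp.smul_apply, smul_eq_mul]; ring)
  have w3 : v + c ∉ affineSpan ℝ ({v, v + a, v + b} : Set E3) := by
    rw [mem_affineSpan_triple]
    rintro ⟨α, β, e⟩
    rw [add_assoc] at e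
    obtain rfl := add_left_cancel e
    exact hd (by simp only [det3, PiLp.add_apply, PiLp.smul_apply, smul_eq_mul]; ring)
  have s0 : stepSign (flagOf v (a, b, c) 0) (flagOf v (a, b, c) 1) = 1 := by
    rw [stepSign_eq (w := v + a) (p₁ := v) (p₂ := v) (τ := 1 / 2) (by simp [flagOf]) ?_
      (by intro x hx hx'; simp [flagOf] at hx hx'; tauto) (by simp [flagOf]) (by simp [flagOf])
      (by rw [z1, hρ]; module)]
    · norm_num
    · have : a ≠ 0 := by rintro rfl; simp at ia
      simpa [flagOf] using this
  have s1 : stepSign (flagOf v (a, b, c) 1) (flagOf v (a, b, c) 2) = if 0 < μ then 1 else -1 := by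
    refine stepSign_eq (w := v + b) (p₁ := v) (p₂ := v + l • a) (by simp [flagOf]) ?_
      (by intro x hx hx'; simp [flagOf] at hx hx'; tauto) ?_ ?_ (by rw [z2]; module)
    · simpa [flagOf] using w2
    · simpa [flagOf] using (mem_affineSpan_add_pair (v := v) (a := a)).2 ⟨0, by simp⟩
    · simpa [flagOf] using (mem_affineSpan_add_pair (v := v) (a := a)).2 ⟨l, rfl⟩
  set C := relCenter v a b c with hC
  have s2 : stepSign (flagOf v (a, b, c) 2) (flagOf v (a, b, c) 3)
      = if 0 < det3 a b C / det3 a b c then 1 else -1 := by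
    have key := cramer a b c C hd
    refine stepSign_eq (w := v + c) (p₁ := v) (p₂ := v + (det3 b c C / det3 a b c) • a
      + (det3 c a C / det3 a b c) • b) (by simp [flagOf, mem_tet]) ?_
      (by intro x hx hx'; simp [flagOf, mem_tet] at hx hx'; tauto) ?_ ?_ ?_
    · simpa [flagOf] using w3
    · simpa [flagOf] using (mem_affineSpan_triple (v := v) (a := a) (b := b)).2 ⟨0, 0, by simp⟩
    · simpa [flagOf] using (mem_affineSpan_triple (v := v) (a := a) (b := b)).2 ⟨_, _, rfl⟩
    · rw [z3]
      nth_rw 1 [key]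
      module
  have hsign : elementarySign (flagOf v (a, b, c))
      = (if 0 < μ then 1 else -1) * (if 0 < det3 a b C / det3 a b c then 1 else -1) := by
    rw [elementarySign, Fin.prod_univ_three]
    change stepSign (flagOf v (a, b, c) 0) (flagOf v (a, b, c) 1)
      * stepSign (flagOf v (a, b, c) 1) (flagOf v (a, b, c) 2)
      * stepSign (flagOf v (a, b, c) 2) (flagOf v (a, b, c) 3) = _
    rw [s0, s1, s2, one_mul]
  have hdet : det3 (v + ρ • a - v) (v + l • a + μ • b - v) (v + C - v)
      = μ / 2 * det3 a b C := by
    rw [hρ]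
    simp only [det3, PiLp.add_apply, PiLp.sub_apply, PiLp.smul_apply, smul_eq_mul]; ring
  rw [hsign, elementaryDual, hκ, z0, z1, z2, z3, hdet, abs_mul, abs_div, abs_two]
  have a1 : (if 0 < μ then 1 else -1) * |μ| = μ := by
    split_ifs with hp
    · rw [abs_of_pos hp, one_mul]
    · rw [abs_of_nonpos (not_lt.1 hp)]; ring
  have a2 : (if 0 < det3 a b C / det3 a b c then 1 else -1) * |det3 a b C|
      = DelaunayFan.height (relCenter v) a b c := by
    rw [DelaunayFan.height, ← hC]
    rcases lt_or_gt_of_ne hd with hn | hp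
    · rw [Real.sign_of_neg hn]
      split_ifs with h1
      · rw [abs_of_neg (((div_pos_iff.1 h1).resolve_left fun h2 => lt_asymm hn h2.2).1)]
        ring
      · rw [abs_of_nonneg (by
          by_contra h2
          exact h1 (div_pos_of_neg_of_neg (not_le.1 h2) hn))]
    · rw [Real.sign_of_pos hp]
      split_ifs with h1
      · rw [abs_of_pos ((div_pos_iff_of_pos_right hp).1 h1)]
      · rw [abs_of_nonpos (by
          by_contra h2
          exact h1 (div_pos (not_le.1 h2) hp))]
        ring
  have e : inner ℝ a a * (inner ℝ b b - inner ℝ a b) / gram a b = 2 * μ := by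
    rw [hμ]; field_simp
  rw [e, ← a2]
  linear_combination (κ / 2 * ((if 0 < det3 a b C / det3 a b c then 1 else -1)
    * |det3 a b C|)) * a1

end Flags

theorem mainTheorem4 (K : Geometry.SimplicialComplex ℝ (EuclideanSpace ℝ (Fin 3)))
    (hK : IsTetrahedralMesh K) (hD : IsDelaunayMesh K)
    (v : EuclideanSpace ℝ (Fin 3)) (hv : IsInternalVertex K v) :
    0 < signedDualVolume K v := by
  obtain ⟨κ, hκ, hvol⟩ := exists_volume_convexHull
  have hF := delaunayFan_of_isInternalVertex hK hD hv
  rw [signedDualVolume, ← finsum_mem_eq_of_bijOn (flagOf v) bijOn_flagOf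
    (f := fun p => κ / 4 * (inner ℝ p.1 p.1 * (inner ℝ p.2.1 p.2.1 - inner ℝ p.1 p.2.1)
      / gram p.1 p.2.1 * DelaunayFan.height (relCenter v) p.1 p.2.1 p.2.2))
    (fun p hp => (elementary_signed_volume hvol hp).symm),
    finsum_mem_eq_finite_toFinset_sum _ (starTriples_finite hK.finite), ← Finset.mul_sum]
  exact mul_pos (by linarith) hF.dual_sum_pos
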